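/- Consider mechanical one-port networks consisting of one damper (admittance $c$, $c>0$), one inerter (admittance $bs$, $b>0$) and at most three springs (admittances $k/s$, $k>0$). Every element, and the driving port, joins two distinct nodes, and the augmented graph (all elements together with the driving port) is connected. Removing the damper and the inerter leaves a three-port spring network $X$ whose ports are the driving port and the terminal pairs of the damper and of the inerter. $X$ has a well-defined admittance if the vector of its port forces is a function $f=Av$ (with a $3\times 3$ matrix $A$ over $\mathbb{R}(s)$) of the vector $v$ of its port velocities, which can be arbitrary. Theorem. A real rational function $Y(s)$ (in particular, a positive-real one) can be realized as the driving-point admittance of such a one-port network for which $X$ does not have a well-defined admittance if and only if $Y(s)$ can be written in the form $$Y(s)=\frac{\alpha_3s^3+\alpha_2s^2+\alpha_1s+\alpha_0}{\beta_3s^3+\beta_2s^2+\beta_1s},$$ where $\alpha_0,\alpha_1,\alpha_2,\alpha_3,\beta_1,\beta_2,\beta_3\ge 0$ and one of the following five conditions holds: 1. $\alpha_3=\beta_2=\beta_3=0$, $\alpha_1,\alpha_2,\beta_1>0$; 2. $\alpha_3=0$, $\beta_2,\beta_3>0$, $\alpha_1\beta_1-\alpha_0\beta_2\ge 0$, $\alpha_1^2+\alpha_0\beta_2^2\ge\alpha_1\beta_1\beta_2$,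 $\alpha_0\beta_2+\beta_2\beta_1^2\ge\alpha_1\beta_1$, $\alpha_1\beta_3=\alpha_2\beta_2$; 3. $\beta_2=0$, $\alpha_3,\beta_3>0$, $\alpha_2\beta_1-\alpha_0\beta_3\ge 0$, $\alpha_2^2+\alpha_0\beta_3^2\ge\alpha_2\beta_1\beta_3$, $\alpha_0\beta_3+\beta_3\beta_1^2\ge\alpha_2\beta_1$, $\alpha_1\beta_3=\alpha_3\beta_1$; 4. $\beta_3=0$, $\alpha_3,\beta_2>0$, $\alpha_1\beta_1-\alpha_0\beta_2\ge 0$, $\alpha_1^2+\alpha_0\beta_2^2\ge\alpha_1\beta_1\beta_2$, $\alpha_0\beta_2+\beta_2\beta_1^2\ge\alpha_1\beta_1$, $\alpha_3\beta_1=\alpha_2\beta_2$; 5. $\alpha_3,\beta_2,\beta_3>0$, $\alpha_1\beta_3+\alpha_2\beta_2\ge\alpha_3\beta_1$, $\alpha_2\beta_2+\alpha_3\beta_1\ge\alpha_1\beta_3$, $\alpha_1\beta_3+\alpha_3\beta_1\ge\alpha_2\beta_2$, $\alpha_3=\beta_2\beta_3$, $\alpha_1^2\beta_3^2+\alpha_2^2\beta_2^2+\alpha_3^2\beta_1^2+4\alpha_0\alpha_3^2=2(\alpha_1\beta_3\alpha_2\beta_2+\alpha_2\beta_2\alpha_3\beta_1+\alpha_3\beta_1\alpha_1\beta_3)$.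 Furthermore, for each of the five conditions, $Y(s)$ can be written in the above form with nonnegative coefficients satisfying that condition if and only if it is the driving-point admittance of the corresponding one of the following networks for some $b,c>0$ and $k_1,k_2,k_3\ge 0$ (a spring with constant $0$ is absent): (a) driving port, damper, inerter and the spring $k_1$ all in parallel; in the other four, on the nodes $0,1,2$, the driving port and $k_1$ join $0$ and $2$, $k_2$ joins $0$ and $1$, $k_3$ joins $1$ and $2$, and (b) the damper and the inerter both join $1$ and $2$; (c) the damper joins $0$ and $2$, the inerter joins $1$ and $2$; (d) the damper joins $1$ and $2$, the inerter joins $0$ and $2$; (e) the damper joins $0$ and $1$, the inerter joins $1$ and $2$. -/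

import Mathlib

/-!
Mechanical one-port networks in the force-current (velocity-voltage) analogy, over the field
`RatFunc ℝ` of real rational functions of the Laplace variable `s` (written `RatFunc.X`).
A spring of stiffness `k` has admittance `k / s`, a damper `c`, an inerter `b * s`.
-/

/-- The graph on the nodes `V` in which two distinct nodes are adjacent when one of the edges
`e : E`, with end nodes `(ends e).1` and `(ends e).2`, joins them. -/
def edgeGraph {V E : Type} (ends : E → V × V) : SimpleGraph V :=
  SimpleGraph.fromRel fun x y => ∃ e, ends e = (x, y)

/-- Incidence coefficient of an oriented edge and a node: `1` at the first end node,
`-1` at the second one, `0` elsewhere. -/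
noncomputable def incidence {V : Type} [DecidableEq V] (e : V × V) (w : V) : RatFunc ℝ :=
  (if w = e.1 then 1 else 0) - (if w = e.2 then 1 else 0)

/-- A multi-port spring network with nodes `V`, ports `P` and springs `S`.
Every port and every spring is an (oriented) edge between two different nodes, and the
augmented graph, made of all port edges and all spring edges, is connected. -/
structure SpringNetwork (V P S : Type) where
  /-- the two terminals of each port -/
  port : P → V × V
  /-- the two end nodes of each spring -/
  spring : S → V × V
  /-- the spring constants -/
  stiffness : S → ℝ
  port_ne : ∀ p, (port p).1 ≠ (port p).2
  spring_ne : ∀ j, (spring j).1 ≠ (spring j).2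
  stiffness_pos : ∀ j, 0 < stiffness j
  connected : (edgeGraph (Sum.elim port spring)).Connected

namespace SpringNetwork

variable {V P S : Type} [DecidableEq V] [Fintype P] [Fintype S]

/-- The pairs (port velocities `v`, port forces `f`) that the network allows: for some node
velocities `u`, the velocity across each port is the difference of the node velocities at its
terminals, and at every node the forces fed in through the ports balance the spring forces. -/
def Behavior (N : SpringNetwork V P S) (v f : P → RatFunc ℝ) : Prop :=
  ∃ u : V → RatFunc ℝ,
    (∀ p, v p = u (N.port p).1 - u (N.port p).2) ∧
    ∀ w : V, ∑ p, incidence (N.port p) w * f p =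
      ∑ j, incidence (N.spring j) w *
        (RatFunc.C (N.stiffness j) / RatFunc.X * (u (N.spring j).1 - u (N.spring j).2))

/-- The network has a well-defined admittance: there is a matrix `A` such that the allowed pairs
are exactly the pairs `(v, A v)`, with `v` arbitrary. -/
def HasWellDefinedAdmittance (N : SpringNetwork V P S) : Prop :=
  ∃ A : Matrix P P (RatFunc ℝ), ∀ v f : P → RatFunc ℝ, N.Behavior v f ↔ f = A.mulVec v

/-- `Y` is the driving-point admittance of the one-port obtained from a three-port spring network
by connecting a damper with coefficient `c` across port `1` and an inerter with inertance `b`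
across port `2`; port `0` is the driving port. The pairs (velocity, force) allowed at the driving
port are exactly the pairs `(x, Y * x)`. -/
def IsDrivingPointAdmittance (N : SpringNetwork V (Fin 3) S) (c b : ℝ) (Y : RatFunc ℝ) : Prop :=
  ∀ x y : RatFunc ℝ,
    (∃ v f : Fin 3 → RatFunc ℝ, N.Behavior v f ∧ v 0 = x ∧ f 0 = y ∧
      f 1 = -(RatFunc.C c * v 1) ∧ f 2 = -(RatFunc.C b * RatFunc.X * v 2)) ↔ y = Y * x

end SpringNetwork

/-- `Y` is the driving-point admittance of a one-port network made of one damper, one inerter and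
at most three springs, whose three-port spring subnetwork (the ports being the driving port and
the terminal pairs of the damper and of the inerter) has no well-defined admittance. -/
def RealizableWithoutAdmittance (Y : RatFunc ℝ) : Prop :=
  ∃ (V S : Type) (_ : Fintype V) (_ : DecidableEq V) (_ : Fintype S)
    (N : SpringNetwork V (Fin 3) S) (c b : ℝ),
    Fintype.card S ≤ 3 ∧ 0 < c ∧ 0 < b ∧
    ¬ N.HasWellDefinedAdmittance ∧ N.IsDrivingPointAdmittance c b Y

/-! The network class is used for the five concrete configurations below. A spring constant that
is allowed to vanish means that the spring is absent in that case. -/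

/-- The spring network with given ports that keeps those springs whose constant is positive;
the port edges alone already connect all nodes. -/
def SpringNetwork.ofConstants {V P ι : Type} (port : P → V × V) (spring : ι → V × V) (k : ι → ℝ)
    (hp : ∀ p, (port p).1 ≠ (port p).2) (hs : ∀ j, (spring j).1 ≠ (spring j).2)
    (hc : (edgeGraph port).Connected) : SpringNetwork V P {j : ι // 0 < k j} where
  port := port
  spring j := spring j.1
  stiffness j := k j.1
  port_ne := hp
  spring_ne j := hs j.1
  stiffness_pos j := j.2
  connected := by
    refine hc.mono fun x y h => ?_
    simp only [edgeGraph, SimpleGraph.fromRel_adj] at h ⊢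
    obtain ⟨hne, h⟩ := h
    exact ⟨hne, h.imp (fun ⟨e, he⟩ => ⟨Sum.inl e, he⟩) (fun ⟨e, he⟩ => ⟨Sum.inl e, he⟩)⟩

theorem edgeGraph_connected_two (port : Fin 3 → Fin 2 × Fin 2) (p : Fin 3)
    (h : port p = (0, 1)) : (edgeGraph port).Connected := by
  have h01 : (edgeGraph port).Adj 0 1 := by
    simp only [edgeGraph, SimpleGraph.fromRel_adj]
    exact ⟨by decide, Or.inl ⟨p, h⟩⟩
  have key : ∀ x : Fin 2, (edgeGraph port).Reachable x 0 := by
    intro x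
    fin_cases x
    · exact SimpleGraph.Reachable.refl _
    · exact h01.symm.reachable
  exact ⟨fun x y => (key x).trans (key y).symm⟩

theorem edgeGraph_connected_three (port : Fin 3 → Fin 3 × Fin 3) (p q : Fin 3)
    (hp : port p = (0, 2)) (hq : port q = (1, 2)) : (edgeGraph port).Connected := by
  have h1 : (edgeGraph port).Adj 0 2 := by
    simp only [edgeGraph, SimpleGraph.fromRel_adj]
    exact ⟨by decide, Or.inl ⟨p, hp⟩⟩
  have h2 : (edgeGraph port).Adj 1 2 := by
    simp only [edgeGraph, SimpleGraph.fromRel_adj]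
    exact ⟨by decide, Or.inl ⟨q, hq⟩⟩
  have key : ∀ x : Fin 3, (edgeGraph port).Reachable x 2 := by
    intro x
    fin_cases x
    · exact h1.reachable
    · exact h2.reachable
    · exact SimpleGraph.Reachable.refl _
  exact ⟨fun x y => (key x).trans (key y).symm⟩

/-- Configuration (a): driving port, damper, inerter and spring `k₁` all in parallel. -/
def networkA (k₁ : ℝ) : SpringNetwork (Fin 2) (Fin 3) {j : Fin 1 // 0 < ![k₁] j} :=
  .ofConstants ![(0, 1), (0, 1), (0, 1)] ![(0, 1)] ![k₁] (by decide) (by decide)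
    (edgeGraph_connected_two _ 0 rfl)

/-- Triangle of springs on the nodes `0, 1, 2`: `k₁` joins `0` and `2`, `k₂` joins `0` and `1`,
`k₃` joins `1` and `2`. -/
def triangleNetwork (port : Fin 3 → Fin 3 × Fin 3) (k₁ k₂ k₃ : ℝ)
    (hp : ∀ p, (port p).1 ≠ (port p).2) (hc : (edgeGraph port).Connected) :
    SpringNetwork (Fin 3) (Fin 3) {j : Fin 3 // 0 < ![k₁, k₂, k₃] j} :=
  .ofConstants port ![(0, 2), (0, 1), (1, 2)] ![k₁, k₂, k₃] hp (by decide) hc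

/-- Configuration (b): driving port across `k₁`, damper and inerter both across `k₃`. -/
def networkB (k₁ k₂ k₃ : ℝ) :
    SpringNetwork (Fin 3) (Fin 3) {j : Fin 3 // 0 < ![k₁, k₂, k₃] j} :=
  triangleNetwork ![(0, 2), (1, 2), (1, 2)] k₁ k₂ k₃ (by decide)
    (edgeGraph_connected_three _ 0 1 rfl rfl)

/-- Configuration (c): driving port and damper across `k₁`, inerter across `k₃`. -/
def networkC (k₁ k₂ k₃ : ℝ) :
    SpringNetwork (Fin 3) (Fin 3) {j : Fin 3 // 0 < ![k₁, k₂, k₃] j} :=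
  triangleNetwork ![(0, 2), (0, 2), (1, 2)] k₁ k₂ k₃ (by decide)
    (edgeGraph_connected_three _ 0 2 rfl rfl)

/-- Configuration (d): driving port and inerter across `k₁`, damper across `k₃`. -/
def networkD (k₁ k₂ k₃ : ℝ) :
    SpringNetwork (Fin 3) (Fin 3) {j : Fin 3 // 0 < ![k₁, k₂, k₃] j} :=
  triangleNetwork ![(0, 2), (1, 2), (0, 2)] k₁ k₂ k₃ (by decide)
    (edgeGraph_connected_three _ 0 1 rfl rfl)

/-- Configuration (e): driving port across `k₁`, damper across `k₂`, inerter across `k₃`. -/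
def networkE (k₁ k₂ k₃ : ℝ) :
    SpringNetwork (Fin 3) (Fin 3) {j : Fin 3 // 0 < ![k₁, k₂, k₃] j} :=
  triangleNetwork ![(0, 2), (0, 1), (1, 2)] k₁ k₂ k₃ (by decide)
    (edgeGraph_connected_three _ 0 2 rfl rfl)

/-- `Y = (α₃ s³ + α₂ s² + α₁ s + α₀) / (β₃ s³ + β₂ s² + β₁ s)` for some nonnegative
coefficients that satisfy the condition `C α₀ α₁ α₂ α₃ β₁ β₂ β₃`. -/
def HasForm (C : ℝ → ℝ → ℝ → ℝ → ℝ → ℝ → ℝ → Prop) (Y : RatFunc ℝ) : Prop :=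
  ∃ α₀ α₁ α₂ α₃ β₁ β₂ β₃ : ℝ,
    0 ≤ α₀ ∧ 0 ≤ α₁ ∧ 0 ≤ α₂ ∧ 0 ≤ α₃ ∧ 0 ≤ β₁ ∧ 0 ≤ β₂ ∧ 0 ≤ β₃ ∧
    C α₀ α₁ α₂ α₃ β₁ β₂ β₃ ∧
    Y = (RatFunc.C α₃ * RatFunc.X ^ 3 + RatFunc.C α₂ * RatFunc.X ^ 2 +
          RatFunc.C α₁ * RatFunc.X + RatFunc.C α₀) /
        (RatFunc.C β₃ * RatFunc.X ^ 3 + RatFunc.C β₂ * RatFunc.X ^ 2 + RatFunc.C β₁ * RatFunc.X)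

/-- First condition on the coefficients. -/
def Cond1 (_α₀ α₁ α₂ α₃ β₁ β₂ β₃ : ℝ) : Prop :=
  α₃ = 0 ∧ β₂ = 0 ∧ β₃ = 0 ∧ 0 < α₁ ∧ 0 < α₂ ∧ 0 < β₁

/-- Second condition on the coefficients. -/
def Cond2 (α₀ α₁ α₂ α₃ β₁ β₂ β₃ : ℝ) : Prop :=
  α₃ = 0 ∧ 0 < β₂ ∧ 0 < β₃ ∧ α₁ * β₁ - α₀ * β₂ ≥ 0 ∧
  α₁ ^ 2 + α₀ * β₂ ^ 2 ≥ α₁ * β₁ * β₂ ∧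
  α₀ * β₂ + β₂ * β₁ ^ 2 ≥ α₁ * β₁ ∧ α₁ * β₃ = α₂ * β₂

/-- Third condition on the coefficients. -/
def Cond3 (α₀ α₁ α₂ α₃ β₁ β₂ β₃ : ℝ) : Prop :=
  β₂ = 0 ∧ 0 < α₃ ∧ 0 < β₃ ∧ α₂ * β₁ - α₀ * β₃ ≥ 0 ∧
  α₂ ^ 2 + α₀ * β₃ ^ 2 ≥ α₂ * β₁ * β₃ ∧
  α₀ * β₃ + β₃ * β₁ ^ 2 ≥ α₂ * β₁ ∧ α₁ * β₃ = α₃ * β₁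

/-- Fourth condition on the coefficients. -/
def Cond4 (α₀ α₁ α₂ α₃ β₁ β₂ β₃ : ℝ) : Prop :=
  β₃ = 0 ∧ 0 < α₃ ∧ 0 < β₂ ∧ α₁ * β₁ - α₀ * β₂ ≥ 0 ∧
  α₁ ^ 2 + α₀ * β₂ ^ 2 ≥ α₁ * β₁ * β₂ ∧
  α₀ * β₂ + β₂ * β₁ ^ 2 ≥ α₁ * β₁ ∧ α₃ * β₁ = α₂ * β₂

/-- Fifth condition on the coefficients. -/
def Cond5 (α₀ α₁ α₂ α₃ β₁ β₂ β₃ : ℝ) : Prop :=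
  0 < α₃ ∧ 0 < β₂ ∧ 0 < β₃ ∧ α₁ * β₃ + α₂ * β₂ ≥ α₃ * β₁ ∧
  α₂ * β₂ + α₃ * β₁ ≥ α₁ * β₃ ∧ α₁ * β₃ + α₃ * β₁ ≥ α₂ * β₂ ∧
  α₃ = β₂ * β₃ ∧
  α₁ ^ 2 * β₃ ^ 2 + α₂ ^ 2 * β₂ ^ 2 + α₃ ^ 2 * β₁ ^ 2 + 4 * α₀ * α₃ ^ 2 =
    2 * (α₁ * β₃ * α₂ * β₂ + α₂ * β₂ * α₃ * β₁ + α₃ * β₁ * α₁ * β₃)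

/-- `Y` is the driving-point admittance of a member of a family of configurations with three
spring constants, for some damper, inerter and nonnegative spring constants. -/
def RealizedBy
    (N : ∀ k₁ k₂ k₃ : ℝ, SpringNetwork (Fin 3) (Fin 3) {j : Fin 3 // 0 < ![k₁, k₂, k₃] j})
    (Y : RatFunc ℝ) : Prop :=
  ∃ c b k₁ k₂ k₃ : ℝ,
    0 < c ∧ 0 < b ∧ 0 ≤ k₁ ∧ 0 ≤ k₂ ∧ 0 ≤ k₃ ∧ (N k₁ k₂ k₃).IsDrivingPointAdmittance c b Y

/-- `Y` is the driving-point admittance of configuration (a) for some damper, inerter and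
nonnegative spring constant. -/
def RealizedByA (Y : RatFunc ℝ) : Prop :=
  ∃ c b k₁ : ℝ,
    0 < c ∧ 0 < b ∧ 0 ≤ k₁ ∧ (networkA k₁).IsDrivingPointAdmittance c b Y

/-! If the three port edges contain no cycle, the port velocities can be prescribed freely and the
force balance then determines the port forces, so an admittance exists (`exists_isResponse`,
`hasWellDefinedAdmittance_of_edgesIndependent`). Without an admittance the ports therefore contain a
cycle: all three are parallel, exactly one pair is parallel, or they form a triangle. In each case
they are signed combinations of one or two independent terminal pairs.

It remains to see which stiffness matrices a spring network can show at two independent pairs.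
Virtual work against indicator functions of level sets of a potential shows that the off-diagonal
entry `y` satisfies `|y| ≤ x` and `|y| ≤ z`, with `x`, `z` the diagonal entries
(`exists_paramount_response`). If `y ≤ 0`, this is the matrix of a triangle of springs `x + y`,
`-y`, `z + y`. If `y > 0`, reversing one pair changes its sign. When the ports form a triangle the
orientations are tied together, but there the two pairs share a node, which forces `y ≤ 0`
(`IsResponse.nonpos_of_common_node`). The damper and the inerter enter quadratically in the port
rows, so reversals are harmless, and every network in question has the driving-point admittance of
one of (a) to (e).

That admittance is a sum of three terms in case (a) and a Schur complement otherwise. In (b), (c),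
(d) its coefficients display `g = k₁ + k₂`, `h = k₂ + k₃` and the determinant `d = g * h - k₂ ^ 2`;
the three inequalities say exactly that `k₂ = √(g * h - d)` is real and at most `g` and `h`. In (e)
all three pairwise sums of spring constants are visible, the inequalities say that the constants
solving this linear system are nonnegative, and the last equation fixes `α₀`. Conversely, the port
velocities of (a) to (e) satisfy a linear relation, so they are not arbitrary. -/

/-- Incidence coefficient of an oriented edge and a node, with values in a ring `R`. -/
def nodeIncidence (R : Type*) [Ring R] {V : Type} [DecidableEq V] (e : V × V) (w : V) : R :=
  (if w = e.1 then 1 else 0) - (if w = e.2 then 1 else 0)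

theorem map_nodeIncidence {R R' : Type*} [Ring R] [Ring R'] (φ : R →+* R') {V : Type}
    [DecidableEq V] (e : V × V) (w : V) :
    φ (nodeIncidence R e w) = nodeIncidence R' e w := by
  simp [nodeIncidence, apply_ite φ]

theorem incidence_eq_C {V : Type} [DecidableEq V] (e : V × V) (w : V) :
    incidence e w = RatFunc.C (nodeIncidence ℝ e w) := by
  rw [map_nodeIncidence]; rfl

theorem sum_nodeIncidence_mul {R : Type*} [Ring R] {V : Type} [DecidableEq V] [Fintype V]
    (e : V × V) (u : V → R) : ∑ w, nodeIncidence R e w * u w = u e.1 - u e.2 := by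
  simp [nodeIncidence, sub_mul, Finset.sum_sub_distrib]

theorem nodeIncidence_swap {R : Type*} [Ring R] {V : Type} [DecidableEq V] (e : V × V) (w : V) :
    nodeIncidence R e.swap w = -nodeIncidence R e w := by
  simp [nodeIncidence]

/-! ### Elastic energy, virtual work and existence of responses. -/

namespace SpringNetwork

/-- The elastic energy form of a spring network. -/
def energy {V P S : Type} [Fintype S] (N : SpringNetwork V P S) (u z : V → ℝ) : ℝ :=
  ∑ j, N.stiffness j * (u (N.spring j).1 - u (N.spring j).2) *
    (z (N.spring j).1 - z (N.spring j).2)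

theorem energy_comm {V P S : Type} [Fintype S] (N : SpringNetwork V P S) (u z : V → ℝ) :
    N.energy u z = N.energy z u :=
  Finset.sum_congr rfl fun j _ => by ring

variable {V P S Q : Type} [DecidableEq V] [Fintype V] [Fintype S] [Fintype Q]

/-- Real node displacements `u` for which the spring forces are balanced by forces `g` applied
along the oriented edges `q`. -/
def IsResponse (N : SpringNetwork V P S) (q : Q → V × V) (u : V → ℝ) (g : Q → ℝ) : Prop :=
  ∀ w, ∑ i, nodeIncidence ℝ (q i) w * g i =
    ∑ j, nodeIncidence ℝ (N.spring j) w *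
      (N.stiffness j * (u (N.spring j).1 - u (N.spring j).2))

/-- Pair the node balance with a potential `z` and exchange the sums. Values in a general ring allow
a real response to be tested against node velocities in `RatFunc ℝ`. -/
theorem IsResponse.virtual_work {N : SpringNetwork V P S} {q : Q → V × V} {u : V → ℝ} {g : Q → ℝ}
    (h : N.IsResponse q u g) {R : Type*} [CommRing R] (φ : ℝ →+* R) (z : V → R) :
    ∑ i, φ (g i) * (z (q i).1 - z (q i).2) =
      ∑ j, φ (N.stiffness j * (u (N.spring j).1 - u (N.spring j).2)) *
        (z (N.spring j).1 - z (N.spring j).2) := by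
  have key : ∑ w, φ (∑ i, nodeIncidence ℝ (q i) w * g i) * z w =
      ∑ w, φ (∑ j, nodeIncidence ℝ (N.spring j) w *
      (N.stiffness j * (u (N.spring j).1 - u (N.spring j).2))) * z w := by
    refine Finset.sum_congr rfl fun w _ => by rw [h w]
  simp only [map_sum, map_mul φ (nodeIncidence ℝ _ _), map_nodeIncidence, Finset.sum_mul] at key
  rw [Finset.sum_comm, Finset.sum_comm (s := Finset.univ (α := V))] at key
  convert key using 2 with i _ j _
  · rw [← sum_nodeIncidence_mul (q i) z, Finset.mul_sum]
    exact Finset.sum_congr rfl fun w _ => by ring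
  · rw [← sum_nodeIncidence_mul (N.spring j) z, Finset.mul_sum]
    exact Finset.sum_congr rfl fun w _ => by ring

theorem IsResponse.work_eq_energy {N : SpringNetwork V P S} {q : Q → V × V} {u : V → ℝ}
    {g : Q → ℝ} (h : N.IsResponse q u g) (z : V → ℝ) :
    ∑ i, g i * (z (q i).1 - z (q i).2) = N.energy u z :=
  h.virtual_work (RingHom.id ℝ) z

/-- The oriented edges `q` are independent: they contain no cycle. -/
def EdgesIndependent (q : Q → V × V) : Prop :=
  ∀ h : Q → ℝ, (∀ w, ∑ i, nodeIncidence ℝ (q i) w * h i = 0) → h = 0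

/-- Fredholm alternative for the system whose unknowns are the node displacements and the edge
forces. The system may be singular, since springs need not connect the nodes, so solvability is
shown by testing against functionals that vanish on the range. -/
theorem exists_isResponse (N : SpringNetwork V P S) {q : Q → V × V} (hq : EdgesIndependent q)
    (v : Q → ℝ) :
    ∃ (u : V → ℝ) (g : Q → ℝ), N.IsResponse q u g ∧ ∀ i, u (q i).1 - u (q i).2 = v i := by
  classical
  let L : ((V → ℝ) × (Q → ℝ)) →ₗ[ℝ] ((V → ℝ) × (Q → ℝ)) :=
    { toFun := fun x => (fun w => ∑ j, nodeIncidence ℝ (N.spring j) w *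
          (N.stiffness j * (x.1 (N.spring j).1 - x.1 (N.spring j).2)) -
          ∑ i, nodeIncidence ℝ (q i) w * x.2 i, fun i => x.1 (q i).1 - x.1 (q i).2)
      map_add' := by
        intro x y
        refine Prod.ext ?_ ?_
        · funext w
          simp only [Prod.fst_add, Prod.snd_add, Pi.add_apply]
          rw [sub_add_sub_comm, ← Finset.sum_add_distrib, ← Finset.sum_add_distrib]
          congr 1 <;> exact Finset.sum_congr rfl fun _ _ => by ring
        · funext i
          simp only [Prod.fst_add, Prod.snd_add, Pi.add_apply]
          ring
      map_smul' := by
        intro a x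
        refine Prod.ext ?_ ?_
        · funext w
          simp only [Prod.smul_fst, Prod.smul_snd, Pi.smul_apply, smul_eq_mul, RingHom.id_apply,
            mul_sub, Finset.mul_sum]
          congr 1 <;> exact Finset.sum_congr rfl fun _ _ => by ring
        · funext i
          simp only [Prod.smul_fst, Prod.smul_snd, Pi.smul_apply, smul_eq_mul, RingHom.id_apply]
          ring }
  by_cases hv : ((0 : V → ℝ), v) ∈ LinearMap.range L
  · obtain ⟨x, hx⟩ := hv
    refine ⟨x.1, x.2, fun w => ?_, fun i => congrFun (congrArg Prod.snd hx) i⟩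
    have := congrFun (congrArg Prod.fst hx) w
    exact (sub_eq_zero.1 this).symm
  · exfalso
    -- A functional killing the range but not `(0, v)` amounts to a potential `z` and edge
    -- coefficients `h`.
    obtain ⟨φ, hφ, hle⟩ := Submodule.exists_le_ker_of_notMem hv
    have hL : ∀ x, φ (L x) = 0 := fun x => hle ⟨x, rfl⟩
    let z : V → ℝ := fun w => φ (Pi.single w 1, 0)
    let h : Q → ℝ := fun i => φ (0, Pi.single i 1)
    have hsingle : ∀ {α : Type} [DecidableEq α] (a : α),
        (fun b => if a = b then (1 : ℝ) else 0) = Pi.single a 1 := by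
      intro α _ a
      funext b
      simp [Pi.single_apply, eq_comm]
    have hrep : ∀ x : (V → ℝ) × (Q → ℝ), φ x = ∑ w, x.1 w * z w + ∑ i, x.2 i * h i := by
      intro x
      have h1 : φ (x.1, 0) = ∑ w, x.1 w * z w := by
        have := LinearMap.pi_apply_eq_sum_univ (φ ∘ₗ LinearMap.inl ℝ _ _) x.1
        rw [LinearMap.comp_apply, LinearMap.inl_apply] at this
        rw [this]
        refine Finset.sum_congr rfl fun w _ => ?_
        simp [z, hsingle]
      have h2 : φ (0, x.2) = ∑ i, x.2 i * h i := by
        have := LinearMap.pi_apply_eq_sum_univ (φ ∘ₗ LinearMap.inr ℝ _ _) x.2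
        rw [LinearMap.comp_apply, LinearMap.inr_apply] at this
        rw [this]
        refine Finset.sum_congr rfl fun i _ => ?_
        simp [h, hsingle]
      rw [← h1, ← h2, ← map_add]
      simp
    have hz : ∀ i, z (q i).1 - z (q i).2 = 0 := by
      intro i
      have := hL (0, Pi.single i 1)
      rw [hrep] at this
      simp [L, Pi.single_apply] at this
      rw [← sum_nodeIncidence_mul]
      exact this
    have htest : ∀ u : V → ℝ, N.energy u z + ∑ i, (u (q i).1 - u (q i).2) * h i = 0 := by
      intro u
      have := hL (u, 0)
      rw [hrep] at this
      simp only [L, LinearMap.coe_mk, AddHom.coe_mk, Pi.zero_apply, mul_zero,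
        Finset.sum_const_zero, sub_zero, Finset.sum_mul] at this
      rw [Finset.sum_comm] at this
      rw [← this]
      congr 1
      refine Finset.sum_congr rfl fun j _ => ?_
      rw [← sum_nodeIncidence_mul (N.spring j) z, Finset.mul_sum]
      exact Finset.sum_congr rfl fun _ _ => by ring
    -- Since `z` has no drop along `q`, testing with `u = z` leaves only its energy. Hence no spring
    -- is strained by `z`, so `h` is balanced at every node and vanishes by independence.
    have hzz : N.energy z z = 0 := by
      have := htest z
      simpa [hz] using this
    have hsp : ∀ j, z (N.spring j).1 - z (N.spring j).2 = 0 := by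
      intro j
      have hnn : ∀ j ∈ Finset.univ, 0 ≤ N.stiffness j * (z (N.spring j).1 - z (N.spring j).2) *
          (z (N.spring j).1 - z (N.spring j).2) := fun j _ => by
        rw [mul_assoc]
        exact mul_nonneg (N.stiffness_pos j).le (mul_self_nonneg _)
      have := (Finset.sum_eq_zero_iff_of_nonneg hnn).1 hzz j (Finset.mem_univ j)
      rw [mul_assoc] at this
      rcases mul_eq_zero.1 this with h | h
      · exact absurd h (N.stiffness_pos j).ne'
      · exact mul_self_eq_zero.1 h
    have hh : h = 0 := by
      refine hq h fun w => ?_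
      have := htest (Pi.single w 1)
      rw [energy_comm] at this
      simp only [energy, hsp, mul_zero, zero_mul, Finset.sum_const_zero, zero_add] at this
      rw [← this]
      refine Finset.sum_congr rfl fun i _ => ?_
      simp [nodeIncidence, Pi.single_apply, eq_comm]
    apply hφ
    rw [hrep]
    simp [hh]

/-! ### Reduction of the ports to independent terminal pairs. -/

variable [Fintype P]

/-- The ports of `N` are combinations, with coefficients `D`, of independent terminal pairs at
which the spring network has the stiffness matrix `G`. -/
def HasReduction (N : SpringNetwork V P S) (D : P → Q → ℝ) (G : Q → Q → ℝ) : Prop :=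
  ∀ v f, N.Behavior v f ↔ ∃ z : Q → RatFunc ℝ, (∀ p, v p = ∑ i, RatFunc.C (D p i) * z i) ∧
    ∀ i, ∑ p, RatFunc.C (D p i) * f p = ∑ r, RatFunc.C (G i r) / RatFunc.X * z r

/-- Velocities transform by `D` and forces by its transpose. The rows `U r` serve both as test
potentials and as a basis for superposition. -/
theorem hasReduction_of_isResponse [DecidableEq Q] (N : SpringNetwork V P S) {q : Q → V × V}
    {D : P → Q → ℝ} {G : Q → Q → ℝ} {U : Q → V → ℝ}
    (hD : ∀ p w, nodeIncidence ℝ (N.port p) w = ∑ i, D p i * nodeIncidence ℝ (q i) w)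
    (hU : ∀ r, N.IsResponse q (U r) (G r))
    (hUq : ∀ r i, U r (q i).1 - U r (q i).2 = if i = r then 1 else 0) :
    N.HasReduction D G := by
  have hdiff : ∀ (p) (u : V → RatFunc ℝ), u (N.port p).1 - u (N.port p).2 =
      ∑ i, RatFunc.C (D p i) * (u (q i).1 - u (q i).2) := by
    intro p u
    simp only [← sum_nodeIncidence_mul, Finset.mul_sum]
    rw [Finset.sum_comm]
    refine Finset.sum_congr rfl fun w _ => ?_
    rw [← map_nodeIncidence RatFunc.C, hD, map_sum, Finset.sum_mul]
    refine Finset.sum_congr rfl fun i _ => ?_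
    rw [map_mul, map_nodeIncidence, mul_assoc]
  have hsymm : ∀ r i, G r i = G i r := by
    have : ∀ r i, G r i = N.energy (U r) (U i) := by
      intro r i
      rw [← (hU r).work_eq_energy]
      simp [hUq]
    intro r i
    rw [this, this, energy_comm]
  intro v f
  constructor
  · rintro ⟨u, hv, hf⟩
    -- The potential `u` need not be a combination of the `U r`, as unloaded parts may float;
    -- testing its balance with `U r` gives the forces anyway.
    refine ⟨fun i => u (q i).1 - u (q i).2, fun p => by rw [hv, hdiff], fun r => ?_⟩
    have key : ∑ w, RatFunc.C (U r w) * ∑ p, incidence (N.port p) w * f p =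
        ∑ w, RatFunc.C (U r w) * ∑ j, incidence (N.spring j) w *
        (RatFunc.C (N.stiffness j) / RatFunc.X * (u (N.spring j).1 - u (N.spring j).2)) :=
      Finset.sum_congr rfl fun w _ => by rw [hf]
    simp only [Finset.mul_sum] at key
    rw [Finset.sum_comm, Finset.sum_comm (s := Finset.univ (α := V))] at key
    have hl : ∀ (e : V × V) (a : RatFunc ℝ),
        ∑ w, RatFunc.C (U r w) * (incidence e w * a) =
          (RatFunc.C (U r e.1) - RatFunc.C (U r e.2)) * a := by
      intro e a
      rw [← sum_nodeIncidence_mul e fun w => RatFunc.C (U r w), Finset.sum_mul]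
      exact Finset.sum_congr rfl fun w _ => by rw [incidence_eq_C, map_nodeIncidence]; ring
    simp only [hl] at key
    have hp : ∀ p, RatFunc.C (U r (N.port p).1) - RatFunc.C (U r (N.port p).2) =
        RatFunc.C (D p r) := by
      intro p
      rw [hdiff p fun w => RatFunc.C (U r w)]
      simp only [← map_sub, hUq]
      simp [apply_ite RatFunc.C]
    simp only [hp] at key
    rw [key]
    have := (hU r).virtual_work RatFunc.C u
    have h2 : ∑ i, RatFunc.C (G r i) / RatFunc.X * (u (q i).1 - u (q i).2) =
        (∑ i, RatFunc.C (G r i) * (u (q i).1 - u (q i).2)) / RatFunc.X := by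
      rw [Finset.sum_div]
      exact Finset.sum_congr rfl fun i _ => by ring
    rw [h2, this, Finset.sum_div]
    refine Finset.sum_congr rfl fun j _ => ?_
    rw [map_mul, map_sub]
    ring
  · rintro ⟨z, hv, hf⟩
    -- Superposition of the unit responses; symmetry of `G` matches its rows with the columns
    -- required here.
    refine ⟨fun w => ∑ r, RatFunc.C (U r w) * z r, fun p => ?_, fun w => ?_⟩
    · rw [hv, hdiff p fun w => ∑ r, RatFunc.C (U r w) * z r]
      refine Finset.sum_congr rfl fun i _ => ?_
      simp only [← Finset.sum_sub_distrib, ← sub_mul, ← map_sub, hUq]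
      simp [apply_ite RatFunc.C]
    · have h1 : ∑ p, incidence (N.port p) w * f p =
          ∑ i, nodeIncidence (RatFunc ℝ) (q i) w * ∑ p, RatFunc.C (D p i) * f p := by
        simp only [Finset.mul_sum]
        rw [Finset.sum_comm]
        refine Finset.sum_congr rfl fun p _ => ?_
        rw [incidence_eq_C, hD, map_sum, Finset.sum_mul]
        refine Finset.sum_congr rfl fun i _ => ?_
        rw [map_mul, map_nodeIncidence]
        ring
      rw [h1]
      simp only [hf, Finset.mul_sum]
      rw [Finset.sum_comm]
      have h2 : ∀ r, ∑ i, nodeIncidence (RatFunc ℝ) (q i) w *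
          (RatFunc.C (G i r) / RatFunc.X * z r) =
          ∑ j, incidence (N.spring j) w * (RatFunc.C (N.stiffness j) / RatFunc.X *
            ((RatFunc.C (U r (N.spring j).1) - RatFunc.C (U r (N.spring j).2)) * z r)) := by
        intro r
        have := congrArg (fun t => RatFunc.C t * (z r / RatFunc.X)) (hU r w)
        simp only [map_sum, map_mul, map_sub, Finset.sum_mul, map_nodeIncidence] at this
        convert this using 2 with i _ j _
        · rw [hsymm i r]; ring
        · rw [incidence_eq_C, map_nodeIncidence]; ring
      simp only [h2]
      rw [Finset.sum_comm]
      refine Finset.sum_congr rfl fun j _ => ?_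
      rw [← Finset.mul_sum, ← Finset.mul_sum, ← Finset.sum_sub_distrib]
      simp only [sub_mul, Finset.sum_sub_distrib]

theorem hasWellDefinedAdmittance_of_edgesIndependent [DecidableEq P] (N : SpringNetwork V P S)
    (h : EdgesIndependent N.port) : N.HasWellDefinedAdmittance := by
  choose U G hU hUq using fun r : P => N.exists_isResponse h fun i => if i = r then 1 else 0
  have hred : N.HasReduction (fun p i => if p = i then (1 : ℝ) else 0) G :=
    N.hasReduction_of_isResponse (fun p w => by simp) hU hUq
  refine ⟨fun i r => RatFunc.C (G i r) / RatFunc.X, fun v f => ?_⟩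
  rw [hred v f]
  simp only [apply_ite RatFunc.C, map_one, map_zero, ite_mul, one_mul, zero_mul,
    Finset.sum_ite_eq, Finset.sum_ite_eq', Finset.mem_univ, if_true]
  constructor
  · rintro ⟨z, hz, hf⟩
    obtain rfl : v = z := funext hz
    exact funext hf
  · rintro rfl
    exact ⟨v, fun _ => rfl, fun _ => rfl⟩

end SpringNetwork

/-! ### Parallel edges, independence and triangles. -/

namespace SpringNetwork

/-- Two oriented edges with the same end nodes. -/
def Parallel {V : Type} (e e' : V × V) : Prop := e' = e ∨ e' = e.swap

theorem Parallel.trans {V : Type} {e e' e'' : V × V} (h : Parallel e e') (h' : Parallel e' e'') :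
    Parallel e e'' := by
  rcases h with rfl | rfl <;> rcases h' with rfl | rfl <;> simp [Parallel]

variable {V S : Type} [DecidableEq V]

theorem Parallel.nodeIncidence {e e' : V × V} (h : Parallel e e') :
    ∃ σ : ℝ, σ * σ = 1 ∧ ∀ w, nodeIncidence ℝ e' w = σ * nodeIncidence ℝ e w := by
  rcases h with rfl | rfl
  · exact ⟨1, by simp, fun w => by simp⟩
  · exact ⟨-1, by simp, fun w => by simp [nodeIncidence_swap]⟩

theorem edgesIndependent_single {e : V × V} (he : e.1 ≠ e.2) : EdgesIndependent ![e] := by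
  intro h hw
  have := hw e.1
  simp [_root_.nodeIncidence, he] at this
  funext i
  fin_cases i
  simpa using this

theorem edgesIndependent_pair {e e' : V × V} (he : e.1 ≠ e.2) (he' : e'.1 ≠ e'.2)
    (hp : ¬ Parallel e e') : EdgesIndependent ![e, e'] := by
  obtain ⟨a, b⟩ := e
  obtain ⟨c, d⟩ := e'
  intro h hw
  simp only [Fin.sum_univ_two, _root_.nodeIncidence, Matrix.cons_val_zero, Matrix.cons_val_one]
    at hw
  simp only [Parallel, Prod.swap, Prod.mk.injEq] at hp he he'
  have ha := hw a
  have hb := hw b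
  have hc := hw c
  have hd := hw d
  have : h 0 = 0 ∧ h 1 = 0 := by grind
  funext i
  fin_cases i
  · exact this.1
  · exact this.2

/-- No coefficient of the dependence vanishes, since two non-parallel edges are independent. A node
met by only one edge would force a zero coefficient, so every end node is shared, and only a
triangle is left. -/
theorem triangle_of_not_edgesIndependent {e₀ e₁ e₂ : V × V} (h₀ : e₀.1 ≠ e₀.2)
    (h₁ : e₁.1 ≠ e₁.2) (h₂ : e₂.1 ≠ e₂.2) (h₀₁ : ¬ Parallel e₀ e₁) (h₀₂ : ¬ Parallel e₀ e₂)
    (h₁₂ : ¬ Parallel e₁ e₂) (h : ¬ EdgesIndependent ![e₀, e₁, e₂]) :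
    ∃ a b c : V, a ≠ b ∧ b ≠ c ∧ a ≠ c ∧ Parallel (a, c) e₀ ∧ Parallel (a, b) e₁ ∧
      Parallel (b, c) e₂ := by
  simp only [EdgesIndependent, not_forall] at h
  obtain ⟨x, hx, hne⟩ := h
  simp only [Fin.sum_univ_three, Matrix.cons_val_zero, Matrix.cons_val_one, Matrix.cons_val] at hx
  have hpair : ∀ {e e' : V × V}, e.1 ≠ e.2 → e'.1 ≠ e'.2 → ¬ Parallel e e' → ∀ y y' : ℝ,
      (∀ w, nodeIncidence ℝ e w * y + nodeIncidence ℝ e' w * y' = 0) → y = 0 ∧ y' = 0 := by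
    intro e e' he he' hp y y' hy
    have := edgesIndependent_pair he he' hp ![y, y'] fun w => by
      simpa [Fin.sum_univ_two] using hy w
    exact ⟨by simpa using congrFun this 0, by simpa using congrFun this 1⟩
  have hx3 : ¬ (x 0 = 0 ∧ x 1 = 0 ∧ x 2 = 0) := fun ⟨a, b, c⟩ => hne (by
    funext i; fin_cases i <;> assumption)
  have x0 : x 0 ≠ 0 := fun h0 => hx3 ⟨h0, hpair h₁ h₂ h₁₂ _ _ fun w => by simpa [h0] using hx w⟩
  have x1 : x 1 ≠ 0 := fun h0 => by
    obtain ⟨p, q⟩ := hpair h₀ h₂ h₀₂ _ _ fun w => by simpa [h0] using hx w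
    exact hx3 ⟨p, h0, q⟩
  have x2 : x 2 ≠ 0 := fun h0 => by
    obtain ⟨p, q⟩ := hpair h₀ h₁ h₀₁ _ _ fun w => by simpa [h0] using hx w
    exact hx3 ⟨p, q, h0⟩
  have hmem : ∀ w, (w = e₀.1 ∨ w = e₀.2 → w = e₁.1 ∨ w = e₁.2 ∨ w = e₂.1 ∨ w = e₂.2) ∧
      (w = e₁.1 ∨ w = e₁.2 → w = e₀.1 ∨ w = e₀.2 ∨ w = e₂.1 ∨ w = e₂.2) ∧
      (w = e₂.1 ∨ w = e₂.2 → w = e₀.1 ∨ w = e₀.2 ∨ w = e₁.1 ∨ w = e₁.2) := by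
    intro w
    have := hx w
    simp only [_root_.nodeIncidence] at this
    grind
  obtain ⟨a, b⟩ := e₀
  obtain ⟨c, d⟩ := e₁
  obtain ⟨e, f⟩ := e₂
  have ma := (hmem a).1 (Or.inl rfl)
  have mb := (hmem b).1 (Or.inr rfl)
  have mc := (hmem c).2.1 (Or.inl rfl)
  have md := (hmem d).2.1 (Or.inr rfl)
  have me := (hmem e).2.2 (Or.inl rfl)
  have mf := (hmem f).2.2 (Or.inr rfl)
  simp only [Parallel, Prod.swap, Prod.mk.injEq] at *
  clear hmem hpair hx hx3 x0 x1 x2 hne x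
  -- The cases are the possible nodes shared by `e₀` and `e₁`.
  by_cases hac : a = c
  · exact ⟨a, d, b, by grind⟩
  by_cases had : a = d
  · exact ⟨a, c, b, by grind⟩
  by_cases hbc : b = c
  · exact ⟨b, d, a, by grind⟩
  · exact ⟨b, c, a, by grind⟩

/-! ### Stiffness matrices at two terminal pairs. -/

variable {P : Type} [Fintype S]

theorem IsResponse.swap_left {N : SpringNetwork V P S} {e e' : V × V} {u : V → ℝ} {x y : ℝ}
    (h : N.IsResponse ![e, e'] u ![x, y]) : N.IsResponse ![e', e] u ![y, x] := by
  intro w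
  rw [← h w]
  simp [Fin.sum_univ_two, add_comm]

theorem IsResponse.reverse_right {N : SpringNetwork V P S} {e e' : V × V} {u : V → ℝ} {x y : ℝ}
    (h : N.IsResponse ![e, e'] u ![x, y]) : N.IsResponse ![e, e'.swap] u ![x, -y] := by
  intro w
  rw [← h w]
  simp [Fin.sum_univ_two, nodeIncidence_swap]

theorem IsResponse.neg {N : SpringNetwork V P S} {e e' : V × V} {u : V → ℝ} {x y : ℝ}
    (h : N.IsResponse ![e, e'] u ![x, y]) : N.IsResponse ![e, e'] (-u) ![-x, -y] := by
  intro w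
  have h1 := h w
  have h2 : ∑ j, nodeIncidence ℝ (N.spring j) w *
      (N.stiffness j * ((-u) (N.spring j).1 - (-u) (N.spring j).2)) =
      -∑ j, nodeIncidence ℝ (N.spring j) w *
      (N.stiffness j * (u (N.spring j).1 - u (N.spring j).2)) := by
    rw [← Finset.sum_neg_distrib]
    refine Finset.sum_congr rfl fun j _ => ?_
    simp only [Pi.neg_apply]
    ring
  rw [h2, ← h1]
  simp [Fin.sum_univ_two]
  ring

/-- Stiffness matrix of a triangle of springs `k₁` (nodes `0, 2`), `k₂` (nodes `0, 1`),
`k₃` (nodes `1, 2`) at the terminal pairs `(0, 2)`, `(1, 2)`. -/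
def triangleStiffness (k₁ k₂ k₃ : ℝ) : Fin 2 → Fin 2 → ℝ :=
  ![![k₁ + k₂, -k₂], ![-k₂, k₂ + k₃]]

/-- At the terminal pairs `e`, `e'` the spring network responds as a triangle of springs. -/
def RespondsAsTriangle (N : SpringNetwork V P S) (e e' : V × V) (k₁ k₂ k₃ : ℝ) : Prop :=
  ∃ U : Fin 2 → V → ℝ, (∀ r, N.IsResponse ![e, e'] (U r) (triangleStiffness k₁ k₂ k₃ r)) ∧
    ∀ r i, U r (![e, e'] i).1 - U r (![e, e'] i).2 = if i = r then 1 else 0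

theorem respondsAsTriangle_of_responses {N : SpringNetwork V P S} {e e' : V × V} {u u' : V → ℝ}
    {x y z : ℝ} (hu : N.IsResponse ![e, e'] u ![x, y]) (hu' : N.IsResponse ![e, e'] u' ![y, z])
    (h1 : u e.1 - u e.2 = 1) (h2 : u e'.1 - u e'.2 = 0) (h3 : u' e.1 - u' e.2 = 0)
    (h4 : u' e'.1 - u' e'.2 = 1) : N.RespondsAsTriangle e e' (x + y) (-y) (z + y) := by
  refine ⟨![u, u'], fun r => ?_, fun r i => ?_⟩
  · fin_cases r
    · simpa [triangleStiffness] using hu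
    · simpa [triangleStiffness] using hu'
  · fin_cases r <;> fin_cases i <;> simp [h1, h2, h3, h4]

variable [Fintype V]

/-- The test function is the indicator of the nodes strictly above the level of `e'`, together with
`e'.1`. It is monotone in `u`, so its energy against `u` is nonnegative; it drops by `1` along `e'`
and by `0` or `1` along `e`. In the former case `0 ≤ g 1`, and `0 ≤ g 0` comes from the energy of
`u`. -/
theorem IsResponse.add_nonneg {N : SpringNetwork V P S} {e e' : V × V} {u : V → ℝ} {g : Fin 2 → ℝ}
    (h : N.IsResponse ![e, e'] u g) (he : u e.1 - u e.2 = 1) (he' : u e'.1 - u e'.2 = 0)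
    (hn : e'.1 ≠ e'.2) : 0 ≤ g 0 + g 1 := by
  classical
  let z : V → ℝ := fun x => if u e'.1 < u x ∨ x = e'.1 then 1 else 0
  have hE : 0 ≤ N.energy u z := by
    refine Finset.sum_nonneg fun j _ => ?_
    rw [mul_assoc]
    refine mul_nonneg (N.stiffness_pos j).le ?_
    simp only [z]
    split_ifs <;> grind
  have h0 : 0 ≤ g 0 := by
    have := h.work_eq_energy u
    simp only [Fin.sum_univ_two, Matrix.cons_val_zero, Matrix.cons_val_one, he, he'] at this
    have h2 : 0 ≤ N.energy u u := Finset.sum_nonneg fun j _ => by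
      rw [mul_assoc]
      exact mul_nonneg (N.stiffness_pos j).le (mul_self_nonneg _)
    linarith
  have hw := h.work_eq_energy z
  simp only [Fin.sum_univ_two, Matrix.cons_val_zero, Matrix.cons_val_one] at hw
  rw [← hw] at hE
  have z1 : z e'.1 = 1 := by simp [z]
  have z2 : z e'.2 = 0 := by
    simp only [z, ite_eq_right_iff, one_ne_zero, imp_false]
    grind
  rw [z1, z2] at hE
  have z3 : z e.1 - z e.2 = 0 ∨ z e.1 - z e.2 = 1 := by
    simp only [z]
    split_ifs <;> grind
  rcases z3 with h3 | h3 <;> rw [h3] at hE <;> linarith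

/-- The indicator of the nodes below the level of `b`, together with `b`, is antitone in `u` and
vanishes at `a` and `c`. Its virtual work is therefore `g 1` alone. -/
theorem IsResponse.nonpos_of_common_node {N : SpringNetwork V P S} {a b c : V} {u : V → ℝ}
    {g : Fin 2 → ℝ} (h : N.IsResponse ![(a, c), (b, c)] u g) (he : u a - u c = 1)
    (he' : u b - u c = 0) (hbc : b ≠ c) : g 1 ≤ 0 := by
  classical
  let z : V → ℝ := fun x => if u x < u b ∨ x = b then 1 else 0
  have hE : N.energy u z ≤ 0 := by
    refine Finset.sum_nonpos fun j _ => ?_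
    rw [mul_assoc]
    refine mul_nonpos_of_nonneg_of_nonpos (N.stiffness_pos j).le ?_
    simp only [z]
    split_ifs <;> grind
  have hw := h.work_eq_energy z
  simp only [Fin.sum_univ_two, Matrix.cons_val_zero, Matrix.cons_val_one] at hw
  rw [← hw] at hE
  have z1 : z b = 1 := by simp [z]
  have z2 : z c = 0 := by
    simp only [z, ite_eq_right_iff, one_ne_zero, imp_false]
    grind
  have z3 : z a = 0 := by
    simp only [z, ite_eq_right_iff, one_ne_zero, imp_false]
    grind
  rw [z1, z2, z3] at hE
  linarith

theorem exists_paramount_response (N : SpringNetwork V P S) {e e' : V × V} (he : e.1 ≠ e.2)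
    (he' : e'.1 ≠ e'.2) (hp : ¬ Parallel e e') :
    ∃ (u u' : V → ℝ) (x y z : ℝ), N.IsResponse ![e, e'] u ![x, y] ∧
      N.IsResponse ![e, e'] u' ![y, z] ∧ u e.1 - u e.2 = 1 ∧ u e'.1 - u e'.2 = 0 ∧
      u' e.1 - u' e.2 = 0 ∧ u' e'.1 - u' e'.2 = 1 ∧ |y| ≤ x ∧ |y| ≤ z := by
  have hi := edgesIndependent_pair he he' hp
  obtain ⟨u, g, hu, hv⟩ := N.exists_isResponse hi ![1, 0]
  obtain ⟨u', g', hu', hv'⟩ := N.exists_isResponse hi ![0, 1]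
  have h1 : u e.1 - u e.2 = 1 := by simpa using hv 0
  have h2 : u e'.1 - u e'.2 = 0 := by simpa using hv 1
  have h3 : u' e.1 - u' e.2 = 0 := by simpa using hv' 0
  have h4 : u' e'.1 - u' e'.2 = 1 := by simpa using hv' 1
  obtain ⟨x, y, rfl⟩ : ∃ x y, g = ![x, y] := ⟨g 0, g 1, by funext i; fin_cases i <;> rfl⟩
  obtain ⟨y', z, rfl⟩ : ∃ x y, g' = ![x, y] := ⟨g' 0, g' 1, by funext i; fin_cases i <;> rfl⟩
  -- Reciprocity: both off-diagonal entries are the mutual energy of `u` and `u'`.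
  have hy : y' = y := by
    have e1 := hu.work_eq_energy u'
    have e2 := hu'.work_eq_energy u
    rw [energy_comm, ← e1] at e2
    simpa [Fin.sum_univ_two, h1, h2, h3, h4] using e2
  subst hy
  have a1 := hu.add_nonneg h1 h2 he'
  have a2 := hu.reverse_right.add_nonneg h1 (by simp only [Prod.fst_swap, Prod.snd_swap]; linarith)
    he'.symm
  have a3 := hu'.swap_left.add_nonneg h4 h3 he
  have a4 := hu'.swap_left.reverse_right.add_nonneg h4
    (by simp only [Prod.fst_swap, Prod.snd_swap]; linarith) he.symm
  simp only [Matrix.cons_val_zero, Matrix.cons_val_one] at a1 a2 a3 a4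
  exact ⟨u, u', x, y', z, hu, hu', h1, h2, h3, h4, abs_le.2 ⟨by linarith, by linarith⟩,
    abs_le.2 ⟨by linarith, by linarith⟩⟩

theorem exists_respondsAsTriangle (N : SpringNetwork V P S) {e e' : V × V} (he : e.1 ≠ e.2)
    (he' : e'.1 ≠ e'.2) (hp : ¬ Parallel e e') :
    ∃ (e'' : V × V) (k₁ k₂ k₃ : ℝ), Parallel e'' e' ∧ 0 ≤ k₁ ∧ 0 ≤ k₂ ∧ 0 ≤ k₃ ∧
      N.RespondsAsTriangle e e'' k₁ k₂ k₃ := by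
  obtain ⟨u, u', x, y, z, hu, hu', h1, h2, h3, h4, hx, hz⟩ := N.exists_paramount_response he he' hp
  rw [abs_le] at hx hz
  rcases le_total y 0 with hy | hy
  · exact ⟨e', x + y, -y, z + y, Or.inl rfl, by linarith, by linarith, by linarith,
      respondsAsTriangle_of_responses hu hu' h1 h2 h3 h4⟩
  -- Reversing `e'` flips the sign of `y`; `u'` is negated to keep a unit drop along the reversed
  -- pair.
  · refine ⟨e'.swap, x + -y, - -y, z + -y, Or.inr (by simp), by linarith, by linarith, by linarith,
      respondsAsTriangle_of_responses (u' := -u') hu.reverse_right ?_ h1 ?_ ?_ ?_⟩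
    · simpa using hu'.neg.reverse_right
    all_goals simp only [Pi.neg_apply, Prod.fst_swap, Prod.snd_swap]; linarith

theorem exists_respondsAsTriangle_of_common_node (N : SpringNetwork V P S) {a b c : V}
    (hac : a ≠ c) (hbc : b ≠ c) (hab : a ≠ b) :
    ∃ k₁ k₂ k₃ : ℝ, 0 ≤ k₁ ∧ 0 ≤ k₂ ∧ 0 ≤ k₃ ∧
      N.RespondsAsTriangle (a, c) (b, c) k₁ k₂ k₃ := by
  obtain ⟨u, u', x, y, z, hu, hu', h1, h2, h3, h4, hx, hz⟩ :=
    N.exists_paramount_response (e := (a, c)) (e' := (b, c)) hac hbc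
      (by simp only [Parallel, Prod.swap, Prod.mk.injEq]; grind)
  rw [abs_le] at hx hz
  have hy := hu.nonpos_of_common_node h1 h2 hbc
  change y ≤ 0 at hy
  exact ⟨x + y, -y, z + y, by linarith, by linarith, by linarith,
    respondsAsTriangle_of_responses hu hu' h1 h2 h3 h4⟩

/-! ### Classification of networks without an admittance. -/

variable [Fintype P]

theorem RespondsAsTriangle.hasReduction {N : SpringNetwork V P S} {e e' : V × V} {k₁ k₂ k₃ : ℝ}
    (h : N.RespondsAsTriangle e e' k₁ k₂ k₃) {D : P → Fin 2 → ℝ} {σ : P → ℝ}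
    (hD : ∀ p w, nodeIncidence ℝ (N.port p) w =
      σ p * (D p 0 * nodeIncidence ℝ e w + D p 1 * nodeIncidence ℝ e' w)) :
    N.HasReduction (fun p i => σ p * D p i) (triangleStiffness k₁ k₂ k₃) := by
  obtain ⟨U, hU, hUq⟩ := h
  refine N.hasReduction_of_isResponse (fun p w => ?_) hU hUq
  rw [hD]
  simp [Fin.sum_univ_two]
  ring

/-- Rows expressing the driving port, the damper and the inerter of configuration (b) through the
terminal pairs `(0, 2)` and `(1, 2)`. -/
def rowsB : Fin 3 → Fin 2 → ℝ := ![![1, 0], ![0, 1], ![0, 1]]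

/-- Port rows of configuration (c); see `rowsB`. -/
def rowsC : Fin 3 → Fin 2 → ℝ := ![![1, 0], ![1, 0], ![0, 1]]

/-- Port rows of configuration (d); see `rowsB`. -/
def rowsD : Fin 3 → Fin 2 → ℝ := ![![1, 0], ![0, 1], ![1, 0]]

/-- Port rows of configuration (e); see `rowsB`. -/
def rowsE : Fin 3 → Fin 2 → ℝ := ![![1, 0], ![1, -1], ![0, 1]]

/-- Up to port orientations, `N` behaves as the triangle network with port rows `D`. -/
def ReducesToTriangle (N : SpringNetwork V P S) (D : P → Fin 2 → ℝ) : Prop :=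
  ∃ (σ : P → ℝ) (k₁ k₂ k₃ : ℝ), (∀ p, σ p * σ p = 1) ∧ 0 ≤ k₁ ∧ 0 ≤ k₂ ∧ 0 ≤ k₃ ∧
    N.HasReduction (fun p i => σ p * D p i) (triangleStiffness k₁ k₂ k₃)

theorem reducesToTriangle_of_not_parallel (N : SpringNetwork V P S) {e e' : V × V}
    (he : e.1 ≠ e.2) (he' : e'.1 ≠ e'.2) (hp : ¬ Parallel e e') {D : P → Fin 2 → ℝ}
    (hD : ∀ p, (Parallel e (N.port p) ∧ D p = ![1, 0]) ∨
      (Parallel e' (N.port p) ∧ D p = ![0, 1])) : N.ReducesToTriangle D := by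
  obtain ⟨e'', k₁, k₂, k₃, hpar, h1, h2, h3, hr⟩ := N.exists_respondsAsTriangle he he' hp
  have hσ : ∀ p, ∃ σ : ℝ, σ * σ = 1 ∧ ∀ w, nodeIncidence ℝ (N.port p) w =
      σ * (D p 0 * nodeIncidence ℝ e w + D p 1 * nodeIncidence ℝ e'' w) := by
    intro p
    rcases hD p with ⟨h, hd⟩ | ⟨h, hd⟩
    · obtain ⟨σ, hs, hw⟩ := h.nodeIncidence
      exact ⟨σ, hs, fun w => by simp [hd, hw]⟩
    · obtain ⟨σ, hs, hw⟩ := (hpar.trans h).nodeIncidence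
      exact ⟨σ, hs, fun w => by simp [hd, hw]⟩
  choose σ hs hw using hσ
  exact ⟨σ, k₁, k₂, k₃, hs, h1, h2, h3, hr.hasReduction hw⟩

/-- Up to port orientations, all ports of `N` are in parallel with one spring. -/
def ReducesToParallel (N : SpringNetwork V P S) : Prop :=
  ∃ (σ : P → ℝ) (k : ℝ), (∀ p, σ p * σ p = 1) ∧ 0 ≤ k ∧
    N.HasReduction (fun p (_ : Fin 1) => σ p) (fun _ _ => k)

theorem reducesToParallel_of_parallel (N : SpringNetwork V P S) {e : V × V} (he : e.1 ≠ e.2)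
    (hp : ∀ p, Parallel e (N.port p)) : N.ReducesToParallel := by
  obtain ⟨u, g, hu, hv⟩ := N.exists_isResponse (edgesIndependent_single he) ![1]
  choose σ hs hw using fun p => (hp p).nodeIncidence
  have hg : 0 ≤ g 0 := by
    have := hu.work_eq_energy u
    simp only [hv, Fin.sum_univ_one, Matrix.cons_val_zero, mul_one] at this
    rw [this]
    exact Finset.sum_nonneg fun j _ => by
      rw [mul_assoc]
      exact mul_nonneg (N.stiffness_pos j).le (mul_self_nonneg _)
  refine ⟨σ, g 0, hs, hg, N.hasReduction_of_isResponse (q := ![e]) (U := fun _ => u)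
    (fun p w => by simp [hw]) (fun _ w => ?_) fun r i => ?_⟩
  · rw [← hu w]
    simp
  · rw [hv]
    fin_cases r
    fin_cases i
    simp

theorem reduces_of_not_hasWellDefinedAdmittance (N : SpringNetwork V (Fin 3) S)
    (h : ¬ N.HasWellDefinedAdmittance) :
    N.ReducesToParallel ∨ N.ReducesToTriangle rowsB ∨ N.ReducesToTriangle rowsC ∨
      N.ReducesToTriangle rowsD ∨ N.ReducesToTriangle rowsE := by
  have hrefl : ∀ e : V × V, Parallel e e := fun e => Or.inl rfl
  by_cases h01 : Parallel (N.port 0) (N.port 1)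
  · by_cases h02 : Parallel (N.port 0) (N.port 2)
    · refine Or.inl (N.reducesToParallel_of_parallel (N.port_ne 0) fun p => ?_)
      fin_cases p
      exacts [hrefl _, h01, h02]
    · refine Or.inr (Or.inr (Or.inl
        (N.reducesToTriangle_of_not_parallel (N.port_ne 0) (N.port_ne 2) h02 fun p => ?_)))
      fin_cases p
      exacts [Or.inl ⟨hrefl _, rfl⟩, Or.inl ⟨h01, rfl⟩, Or.inr ⟨hrefl _, rfl⟩]
  by_cases h02 : Parallel (N.port 0) (N.port 2)
  · refine Or.inr (Or.inr (Or.inr (Or.inl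
      (N.reducesToTriangle_of_not_parallel (N.port_ne 0) (N.port_ne 1) h01 fun p => ?_))))
    fin_cases p
    exacts [Or.inl ⟨hrefl _, rfl⟩, Or.inr ⟨hrefl _, rfl⟩, Or.inl ⟨h02, rfl⟩]
  by_cases h12 : Parallel (N.port 1) (N.port 2)
  · refine Or.inr (Or.inl
      (N.reducesToTriangle_of_not_parallel (N.port_ne 0) (N.port_ne 1) h01 fun p => ?_))
    fin_cases p
    exacts [Or.inl ⟨hrefl _, rfl⟩, Or.inr ⟨hrefl _, rfl⟩, Or.inr ⟨h12, rfl⟩]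
  have hdep : ¬ EdgesIndependent ![N.port 0, N.port 1, N.port 2] := fun hi => by
    refine h (N.hasWellDefinedAdmittance_of_edgesIndependent ?_)
    convert hi using 1
    funext p
    fin_cases p <;> rfl
  obtain ⟨a, b, c, hab, hbc, hac, hp0, hp1, hp2⟩ :=
    triangle_of_not_edgesIndependent (N.port_ne 0) (N.port_ne 1) (N.port_ne 2) h01 h02 h12 hdep
  obtain ⟨k₁, k₂, k₃, h1, h2, h3, hr⟩ := N.exists_respondsAsTriangle_of_common_node hac hbc hab
  obtain ⟨s0, hs0, hw0⟩ := hp0.nodeIncidence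
  obtain ⟨s1, hs1, hw1⟩ := hp1.nodeIncidence
  obtain ⟨s2, hs2, hw2⟩ := hp2.nodeIncidence
  refine Or.inr (Or.inr (Or.inr (Or.inr ⟨![s0, s1, s2], k₁, k₂, k₃, fun p => ?_, h1, h2, h3,
    hr.hasReduction fun p w => ?_⟩)))
  · fin_cases p
    exacts [hs0, hs1, hs2]
  · fin_cases p
    · simp [hw0, rowsE]
    -- The edge `(a, b)` is `(a, c)` minus `(b, c)`, whence the row `![1, -1]`.
    · simp only [rowsE, Fin.mk_one, Matrix.cons_val_one, Matrix.cons_val_zero, hw1]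
      simp only [_root_.nodeIncidence]
      ring
    · simp [hw2, rowsE]

end SpringNetwork

/-! ### Driving-point admittance of a reduced network. -/

namespace SpringNetwork

section

variable {V S Q : Type} [DecidableEq V] [Fintype S]

/-- Admittance matrix at the terminal pairs of a reduction, after the damper `c` and the inerter
`b` have been connected across ports `1` and `2`. -/
noncomputable def loadedAdmittance (D : Fin 3 → Q → ℝ) (G : Q → Q → ℝ) (c b : ℝ) (i r : Q) :
    RatFunc ℝ :=
  RatFunc.C (G i r) / RatFunc.X + RatFunc.C (c * (D 1 i * D 1 r)) +
    RatFunc.C (b * (D 2 i * D 2 r)) * RatFunc.X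

theorem loadedAdmittance_reorient {σ : Fin 3 → ℝ} (hσ : ∀ p, σ p * σ p = 1) (D : Fin 3 → Q → ℝ)
    (G : Q → Q → ℝ) (c b : ℝ) :
    loadedAdmittance (fun p i => σ p * D p i) G c b = loadedAdmittance D G c b := by
  funext i r
  simp only [loadedAdmittance]
  rw [mul_mul_mul_comm (σ 1), mul_mul_mul_comm (σ 2), hσ, hσ, one_mul, one_mul]

variable [Fintype Q]

theorem HasReduction.isDrivingPointAdmittance_iff {N : SpringNetwork V (Fin 3) S}
    {D : Fin 3 → Q → ℝ} {G : Q → Q → ℝ} (h : N.HasReduction D G) (c b : ℝ) (Y : RatFunc ℝ) :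
    N.IsDrivingPointAdmittance c b Y ↔ ∀ x y : RatFunc ℝ, (∃ z : Q → RatFunc ℝ,
      ∑ i, RatFunc.C (D 0 i) * z i = x ∧
      ∀ i, RatFunc.C (D 0 i) * y = ∑ r, loadedAdmittance D G c b i r * z r) ↔ y = Y * x := by
  refine forall_congr' fun x => forall_congr' fun y => iff_congr ?_ Iff.rfl
  have hexp : ∀ (z : Q → RatFunc ℝ) (i : Q), ∑ r, loadedAdmittance D G c b i r * z r =
      ∑ r, RatFunc.C (G i r) / RatFunc.X * z r +
      RatFunc.C (D 1 i) * (RatFunc.C c * ∑ r, RatFunc.C (D 1 r) * z r) +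
      RatFunc.C (D 2 i) * (RatFunc.C b * RatFunc.X * ∑ r, RatFunc.C (D 2 r) * z r) := by
    intro z i
    simp only [Finset.mul_sum, ← Finset.sum_add_distrib]
    refine Finset.sum_congr rfl fun r _ => ?_
    simp only [loadedAdmittance, map_mul]
    ring
  constructor
  · rintro ⟨v, f, hB, rfl, rfl, h1, h2⟩
    obtain ⟨z, hv, hf⟩ := (h v f).1 hB
    refine ⟨z, (hv 0).symm, fun i => ?_⟩
    rw [hexp, ← hf i, Fin.sum_univ_three, h1, h2, ← hv 1, ← hv 2]
    ring
  · rintro ⟨z, hx, hy⟩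
    refine ⟨fun p => ∑ i, RatFunc.C (D p i) * z i,
      ![y, -(RatFunc.C c * ∑ i, RatFunc.C (D 1 i) * z i),
        -(RatFunc.C b * RatFunc.X * ∑ i, RatFunc.C (D 2 i) * z i)],
      (h _ _).2 ⟨z, fun _ => rfl, fun i => ?_⟩, hx, rfl, rfl, rfl⟩
    have := hy i
    rw [hexp] at this
    simp only [Fin.sum_univ_three, Matrix.cons_val_zero, Matrix.cons_val_one, Matrix.cons_val]
    linear_combination this

theorem HasReduction.isDrivingPointAdmittance_iff_one {N : SpringNetwork V (Fin 3) S}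
    {σ : Fin 3 → ℝ} {k : ℝ} (hσ : ∀ p, σ p * σ p = 1)
    (h : N.HasReduction (fun p (_ : Fin 1) => σ p) (fun _ _ => k)) (c b : ℝ) (Y : RatFunc ℝ) :
    N.IsDrivingPointAdmittance c b Y ↔
      Y = RatFunc.C k / RatFunc.X + RatFunc.C c + RatFunc.C b * RatFunc.X := by
  rw [h.isDrivingPointAdmittance_iff]
  have hs : RatFunc.C (σ 0) * RatFunc.C (σ 0) = 1 := by rw [← map_mul, hσ, map_one]
  simp only [loadedAdmittance, hσ, mul_one, Fin.sum_univ_one, forall_const]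
  set m := RatFunc.C k / RatFunc.X + RatFunc.C c + RatFunc.C b * RatFunc.X
  constructor
  · intro H
    have := (H 1 m).1 ⟨fun _ => RatFunc.C (σ 0), hs, by ring⟩
    rw [this, mul_one]
  · rintro rfl x y
    constructor
    · rintro ⟨z, rfl, hy⟩
      linear_combination RatFunc.C (σ 0) * hy - y * hs
    · rintro rfl
      exact ⟨fun _ => RatFunc.C (σ 0) * x, by linear_combination x * hs, by ring⟩

/-- Schur complement of a two-by-two admittance matrix: the admittance at the first terminal pair
when the second one is left free. -/
noncomputable def schurAdmittance (M : Fin 2 → Fin 2 → RatFunc ℝ) : RatFunc ℝ :=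
  M 0 0 - M 0 1 * M 1 0 / M 1 1

theorem HasReduction.isDrivingPointAdmittance_iff_two {N : SpringNetwork V (Fin 3) S}
    {D : Fin 3 → Fin 2 → ℝ} {G : Fin 2 → Fin 2 → ℝ} {σ : Fin 3 → ℝ} (hσ : ∀ p, σ p * σ p = 1)
    (hD : D 0 = ![1, 0]) (h : N.HasReduction (fun p i => σ p * D p i) G) {c b : ℝ}
    (hM : loadedAdmittance D G c b 1 1 ≠ 0) (Y : RatFunc ℝ) :
    N.IsDrivingPointAdmittance c b Y ↔ Y = schurAdmittance (loadedAdmittance D G c b) := by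
  rw [h.isDrivingPointAdmittance_iff]
  have hs : RatFunc.C (σ 0) * RatFunc.C (σ 0) = 1 := by rw [← map_mul, hσ, map_one]
  simp only [loadedAdmittance_reorient hσ, hD, Fin.sum_univ_two, Fin.forall_fin_two,
    Matrix.cons_val_zero, Matrix.cons_val_one, mul_one, mul_zero, map_zero, zero_mul, add_zero,
    schurAdmittance]
  set M := loadedAdmittance D G c b
  set s := RatFunc.C (σ 0)
  constructor
  · intro H
    -- Unit velocity at the driving port, with the second coordinate chosen so that no force acts on
    -- the second pair.
    have := (H 1 (M 0 0 - M 0 1 * M 1 0 / M 1 1)).1 ⟨![s, -(s * M 1 0 / M 1 1)], by simpa using hs, by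
      simp only [Matrix.cons_val_zero, Matrix.cons_val_one]; ring, by
      simp only [Matrix.cons_val_zero, Matrix.cons_val_one]; field_simp; ring⟩
    rw [this, mul_one]
  · rintro rfl x y
    constructor
    · rintro ⟨z, rfl, h0, h1⟩
      have h2 : z 1 = -(M 1 0 * z 0) / M 1 1 := by
        rw [eq_div_iff hM]
        linear_combination -h1
      rw [h2] at h0
      linear_combination s * h0 - y * hs
    · rintro rfl
      refine ⟨![s * x, -(s * x * M 1 0 / M 1 1)], ?_, ?_, ?_⟩ <;>
        simp only [Matrix.cons_val_zero, Matrix.cons_val_one]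
      · linear_combination x * hs
      · ring
      · field_simp
        ring

end

/-- Guarantees a nonzero pivot for the Schur complement even when `k₂ + k₃ = 0`: the damper or the
inerter across the second pair suffices. -/
theorem quadratic_ne_zero {p q r : ℝ} (h : q ≠ 0 ∨ r ≠ 0) :
    RatFunc.C p + RatFunc.C q * RatFunc.X + RatFunc.C r * RatFunc.X ^ 2 ≠ (0 : RatFunc ℝ) := by
  intro h0
  have h1 : algebraMap (Polynomial ℝ) (RatFunc ℝ) (Polynomial.C p + Polynomial.C q * Polynomial.X +
      Polynomial.C r * Polynomial.X ^ 2) = 0 := by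
    simpa [RatFunc.algebraMap_C, RatFunc.algebraMap_X] using h0
  have h2 := (map_eq_zero_iff _ (RatFunc.algebraMap_injective ℝ)).1 h1
  have c1 := congrArg (fun f => Polynomial.coeff f 1) h2
  have c2 := congrArg (fun f => Polynomial.coeff f 2) h2
  simp [Polynomial.coeff_C, Polynomial.coeff_X_pow] at c1 c2
  tauto

/-- The driving-point admittance of the triangle network with port rows `D`. -/
noncomputable def triangleAdmittance (D : Fin 3 → Fin 2 → ℝ) (c b k₁ k₂ k₃ : ℝ) : RatFunc ℝ :=
  schurAdmittance (loadedAdmittance D (triangleStiffness k₁ k₂ k₃) c b)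

theorem HasReduction.isDrivingPointAdmittance_iff_triangle {V S : Type} [DecidableEq V]
    [Fintype S] {N : SpringNetwork V (Fin 3) S} {D : Fin 3 → Fin 2 → ℝ} {k₁ k₂ k₃ : ℝ}
    {σ : Fin 3 → ℝ} (hσ : ∀ p, σ p * σ p = 1) (hD : D 0 = ![1, 0]) (hD' : D 1 1 ≠ 0 ∨ D 2 1 ≠ 0)
    (h : N.HasReduction (fun p i => σ p * D p i) (triangleStiffness k₁ k₂ k₃)) {c b : ℝ}
    (hc : 0 < c) (hb : 0 < b) (Y : RatFunc ℝ) :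
    N.IsDrivingPointAdmittance c b Y ↔ Y = triangleAdmittance D c b k₁ k₂ k₃ := by
  refine h.isDrivingPointAdmittance_iff_two hσ hD (fun h0 => ?_) Y
  have hne := quadratic_ne_zero (p := k₂ + k₃) (q := c * (D 1 1 * D 1 1))
    (r := b * (D 2 1 * D 2 1)) (by
      rcases hD' with h | h
      · exact Or.inl (mul_ne_zero hc.ne' (mul_ne_zero h h))
      · exact Or.inr (mul_ne_zero hb.ne' (mul_ne_zero h h)))
  apply hne
  have hX : (RatFunc.X : RatFunc ℝ) ≠ 0 := RatFunc.X_ne_zero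
  have : loadedAdmittance D (triangleStiffness k₁ k₂ k₃) c b 1 1 * RatFunc.X = 0 := by
    rw [h0, zero_mul]
  rw [← this]
  simp only [loadedAdmittance, triangleStiffness, Matrix.cons_val_one, Matrix.cons_val_zero]
  field_simp

/-! ### Reductions of the concrete networks (a) to (e). -/

theorem sum_subtype_pos_mul {ι : Type} [Fintype ι] {k : ι → ℝ} (hk : ∀ j, 0 ≤ k j) (F : ι → ℝ) :
    ∑ j : {j // 0 < k j}, k j * F j = ∑ j, k j * F j := by
  classical
  rw [← Finset.sum_subtype (Finset.univ.filter fun j => 0 < k j) (by simp) fun j => k j * F j,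
    Finset.sum_filter]
  refine Finset.sum_congr rfl fun j _ => ?_
  split_ifs with h
  · rfl
  · rw [le_antisymm (not_lt.1 h) (hk j), zero_mul]

theorem triangleNetwork_hasReduction {port : Fin 3 → Fin 3 × Fin 3} {k₁ k₂ k₃ : ℝ}
    (hp : ∀ p, (port p).1 ≠ (port p).2) (hc : (edgeGraph port).Connected)
    (h₁ : 0 ≤ k₁) (h₂ : 0 ≤ k₂) (h₃ : 0 ≤ k₃) {D : Fin 3 → Fin 2 → ℝ}
    (hD : ∀ p w, nodeIncidence ℝ (port p) w =
      D p 0 * nodeIncidence ℝ (0, 2) w + D p 1 * nodeIncidence ℝ (1, 2) w) :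
    (triangleNetwork port k₁ k₂ k₃ hp hc).HasReduction (fun p i => 1 * D p i)
      (triangleStiffness k₁ k₂ k₃) := by
  -- The unit responses hold node `2` at zero and raise node `0` or node `1` to one. The factor `1`
  -- in the rows is the trivial choice of port orientations.
  refine RespondsAsTriangle.hasReduction (e := (0, 2)) (e' := (1, 2)) (σ := fun _ => 1)
    ⟨![![1, 0, 0], ![0, 1, 0]], fun r w => ?_, fun r i => ?_⟩ fun p w => by
      rw [one_mul, ← hD]; rfl
  · have hk : ∀ j, 0 ≤ ![k₁, k₂, k₃] j := fun j => by fin_cases j <;> assumption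
    have := sum_subtype_pos_mul hk fun j => nodeIncidence ℝ
      ((![(0, 2), (0, 1), (1, 2)] : Fin 3 → Fin 3 × Fin 3) j) w *
      ((![![1, 0, 0], ![0, 1, 0]] : Fin 2 → Fin 3 → ℝ) r
        ((![(0, 2), (0, 1), (1, 2)] : Fin 3 → Fin 3 × Fin 3) j).1 -
        (![![1, 0, 0], ![0, 1, 0]] : Fin 2 → Fin 3 → ℝ) r
        ((![(0, 2), (0, 1), (1, 2)] : Fin 3 → Fin 3 × Fin 3) j).2)
    trans
    swap
    · refine Eq.trans this.symm (Finset.sum_congr rfl fun j _ => ?_)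
      exact mul_left_comm _ _ _
    · rw [Fin.sum_univ_three, Fin.sum_univ_two]
      fin_cases r <;> fin_cases w <;> simp [nodeIncidence, triangleStiffness]
  · fin_cases r <;> fin_cases i <;> simp

theorem networkA_hasReduction {k : ℝ} (hk : 0 ≤ k) :
    (networkA k).HasReduction (fun _ (_ : Fin 1) => 1) (fun _ _ => k) := by
  refine hasReduction_of_isResponse _ (q := ![(0, 1)]) (U := fun _ => ![1, 0])
    (fun p w => ?_) (fun r w => ?_) fun r i => ?_
  · fin_cases p <;> simp [networkA, ofConstants]
  · have hk : ∀ j, 0 ≤ ![k] j := fun j => by fin_cases j; exact hk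
    have := sum_subtype_pos_mul hk fun j => nodeIncidence ℝ
      ((![(0, 1)] : Fin 1 → Fin 2 × Fin 2) j) w *
      ((![1, 0] : Fin 2 → ℝ) ((![(0, 1)] : Fin 1 → Fin 2 × Fin 2) j).1 -
        (![1, 0] : Fin 2 → ℝ) ((![(0, 1)] : Fin 1 → Fin 2 × Fin 2) j).2)
    trans
    swap
    · refine Eq.trans this.symm (Finset.sum_congr rfl fun j _ => ?_)
      exact mul_left_comm _ _ _
    · simp [mul_comm]
  · fin_cases r; fin_cases i; simp

theorem networkB_hasReduction {k₁ k₂ k₃ : ℝ} (h₁ : 0 ≤ k₁) (h₂ : 0 ≤ k₂) (h₃ : 0 ≤ k₃) :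
    (networkB k₁ k₂ k₃).HasReduction (fun p i => 1 * rowsB p i) (triangleStiffness k₁ k₂ k₃) :=
  triangleNetwork_hasReduction _ _ h₁ h₂ h₃ fun p w => by fin_cases p <;> simp [rowsB]

theorem networkC_hasReduction {k₁ k₂ k₃ : ℝ} (h₁ : 0 ≤ k₁) (h₂ : 0 ≤ k₂) (h₃ : 0 ≤ k₃) :
    (networkC k₁ k₂ k₃).HasReduction (fun p i => 1 * rowsC p i) (triangleStiffness k₁ k₂ k₃) :=
  triangleNetwork_hasReduction _ _ h₁ h₂ h₃ fun p w => by fin_cases p <;> simp [rowsC]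

theorem networkD_hasReduction {k₁ k₂ k₃ : ℝ} (h₁ : 0 ≤ k₁) (h₂ : 0 ≤ k₂) (h₃ : 0 ≤ k₃) :
    (networkD k₁ k₂ k₃).HasReduction (fun p i => 1 * rowsD p i) (triangleStiffness k₁ k₂ k₃) :=
  triangleNetwork_hasReduction _ _ h₁ h₂ h₃ fun p w => by fin_cases p <;> simp [rowsD]

theorem networkE_hasReduction {k₁ k₂ k₃ : ℝ} (h₁ : 0 ≤ k₁) (h₂ : 0 ≤ k₂) (h₃ : 0 ≤ k₃) :
    (networkE k₁ k₂ k₃).HasReduction (fun p i => 1 * rowsE p i) (triangleStiffness k₁ k₂ k₃) :=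
  triangleNetwork_hasReduction _ _ h₁ h₂ h₃ fun p w => by
    fin_cases p <;> fin_cases w <;> simp [rowsE, nodeIncidence]

/-- `Y` is the driving-point admittance of a triangle network with port rows `D`. -/
def IsTriangleAdmittance (D : Fin 3 → Fin 2 → ℝ) (Y : RatFunc ℝ) : Prop :=
  ∃ c b k₁ k₂ k₃ : ℝ, 0 < c ∧ 0 < b ∧ 0 ≤ k₁ ∧ 0 ≤ k₂ ∧ 0 ≤ k₃ ∧
    Y = triangleAdmittance D c b k₁ k₂ k₃

theorem realizedBy_iff
    {N : ∀ k₁ k₂ k₃ : ℝ, SpringNetwork (Fin 3) (Fin 3) {j : Fin 3 // 0 < ![k₁, k₂, k₃] j}}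
    {D : Fin 3 → Fin 2 → ℝ} (hD : D 0 = ![1, 0]) (hD' : D 1 1 ≠ 0 ∨ D 2 1 ≠ 0)
    (h : ∀ {k₁ k₂ k₃ : ℝ}, 0 ≤ k₁ → 0 ≤ k₂ → 0 ≤ k₃ →
      (N k₁ k₂ k₃).HasReduction (fun p i => 1 * D p i) (triangleStiffness k₁ k₂ k₃))
    (Y : RatFunc ℝ) : RealizedBy N Y ↔ IsTriangleAdmittance D Y := by
  constructor
  · rintro ⟨c, b, k₁, k₂, k₃, hc, hb, h₁, h₂, h₃, hY⟩
    exact ⟨c, b, k₁, k₂, k₃, hc, hb, h₁, h₂, h₃, ((h h₁ h₂ h₃).isDrivingPointAdmittance_iff_triangle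
      (σ := fun _ => 1) (fun _ => one_mul 1) hD hD' hc hb Y).1 hY⟩
  · rintro ⟨c, b, k₁, k₂, k₃, hc, hb, h₁, h₂, h₃, hY⟩
    exact ⟨c, b, k₁, k₂, k₃, hc, hb, h₁, h₂, h₃, ((h h₁ h₂ h₃).isDrivingPointAdmittance_iff_triangle
      (σ := fun _ => 1) (fun _ => one_mul 1) hD hD' hc hb Y).2 hY⟩

theorem ReducesToTriangle.isTriangleAdmittance {V S : Type} [DecidableEq V] [Fintype S]
    {N : SpringNetwork V (Fin 3) S} {D : Fin 3 → Fin 2 → ℝ} (h : N.ReducesToTriangle D)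
    (hD : D 0 = ![1, 0]) (hD' : D 1 1 ≠ 0 ∨ D 2 1 ≠ 0) {c b : ℝ} (hc : 0 < c) (hb : 0 < b)
    {Y : RatFunc ℝ} (hY : N.IsDrivingPointAdmittance c b Y) : IsTriangleAdmittance D Y := by
  obtain ⟨σ, k₁, k₂, k₃, hσ, h₁, h₂, h₃, hr⟩ := h
  exact ⟨c, b, k₁, k₂, k₃, hc, hb, h₁, h₂, h₃,
    (hr.isDrivingPointAdmittance_iff_triangle hσ hD hD' hc hb Y).1 hY⟩

theorem realizedByA_iff (Y : RatFunc ℝ) : RealizedByA Y ↔ ∃ c b k : ℝ, 0 < c ∧ 0 < b ∧ 0 ≤ k ∧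
    Y = RatFunc.C k / RatFunc.X + RatFunc.C c + RatFunc.C b * RatFunc.X := by
  constructor
  · rintro ⟨c, b, k, hc, hb, hk, hY⟩
    exact ⟨c, b, k, hc, hb, hk, ((networkA_hasReduction hk).isDrivingPointAdmittance_iff_one
      (σ := fun _ => 1) (fun _ => one_mul 1) c b Y).1 hY⟩
  · rintro ⟨c, b, k, hc, hb, hk, hY⟩
    exact ⟨c, b, k, hc, hb, hk, ((networkA_hasReduction hk).isDrivingPointAdmittance_iff_one
      (σ := fun _ => 1) (fun _ => one_mul 1) c b Y).2 hY⟩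

theorem ReducesToParallel.realizedByA {V S : Type} [DecidableEq V] [Fintype S]
    {N : SpringNetwork V (Fin 3) S} (h : N.ReducesToParallel) {c b : ℝ} (hc : 0 < c) (hb : 0 < b)
    {Y : RatFunc ℝ} (hY : N.IsDrivingPointAdmittance c b Y) : RealizedByA Y := by
  obtain ⟨σ, k, hσ, hk, hr⟩ := h
  exact (realizedByA_iff Y).2 ⟨c, b, k, hc, hb, hk,
    (hr.isDrivingPointAdmittance_iff_one hσ c b Y).1 hY⟩

end SpringNetwork

/-! ### Coefficients of the admittances and the five conditions. -/

namespace SpringNetwork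

/-- The rational function of `HasForm` with given coefficients. -/
noncomputable def cubicForm (α₀ α₁ α₂ α₃ β₁ β₂ β₃ : ℝ) : RatFunc ℝ :=
  (RatFunc.C α₃ * RatFunc.X ^ 3 + RatFunc.C α₂ * RatFunc.X ^ 2 +
      RatFunc.C α₁ * RatFunc.X + RatFunc.C α₀) /
    (RatFunc.C β₃ * RatFunc.X ^ 3 + RatFunc.C β₂ * RatFunc.X ^ 2 + RatFunc.C β₁ * RatFunc.X)

theorem schur_eq_div {K : Type*} [Field K] {X p q r s a₁₁ a₁₂ a₂₁ a₂₂ : K} (hX : X ≠ 0)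
    (h : p + q * X + r * X ^ 2 ≠ 0) (h₂₂ : a₂₂ = p / X + q + r * X)
    (hnum : (a₁₁ * a₂₂ - a₁₂ * a₂₁) * X ^ 2 = s) :
    a₁₁ - a₁₂ * a₂₁ / a₂₂ = s / (r * X ^ 3 + q * X ^ 2 + p * X) := by
  have h1 : r * X ^ 3 + q * X ^ 2 + p * X = a₂₂ * X ^ 2 := by
    rw [h₂₂]; field_simp; ring
  have h2 : a₂₂ ≠ 0 := by
    intro h0
    apply h
    rw [h0] at h₂₂
    field_simp at h₂₂
    linear_combination -h₂₂
  rw [h1, ← hnum]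
  field_simp

theorem triangleAdmittance_rowsB {c b : ℝ} (hc : 0 < c) (k₁ k₂ k₃ : ℝ) :
    triangleAdmittance rowsB c b k₁ k₂ k₃ =
      cubicForm (k₁ * k₂ + k₁ * k₃ + k₂ * k₃) (c * (k₁ + k₂)) (b * (k₁ + k₂)) 0 (k₂ + k₃) c b := by
  have hX : (RatFunc.X : RatFunc ℝ) ≠ 0 := RatFunc.X_ne_zero
  have hq := quadratic_ne_zero (p := k₂ + k₃) (q := c) (r := b) (Or.inl hc.ne')
  unfold triangleAdmittance schurAdmittance cubicForm
  refine schur_eq_div hX hq ?_ ?_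
  · simp [loadedAdmittance, triangleStiffness, rowsB]
  · simp [loadedAdmittance, triangleStiffness, rowsB]
    field_simp
    ring

theorem triangleAdmittance_rowsC {c b : ℝ} (hb : 0 < b) (k₁ k₂ k₃ : ℝ) :
    triangleAdmittance rowsC c b k₁ k₂ k₃ =
      cubicForm (k₁ * k₂ + k₁ * k₃ + k₂ * k₃) (c * (k₂ + k₃)) (b * (k₁ + k₂)) (c * b)
        (k₂ + k₃) 0 b := by
  have hX : (RatFunc.X : RatFunc ℝ) ≠ 0 := RatFunc.X_ne_zero
  have hq := quadratic_ne_zero (p := k₂ + k₃) (q := 0) (r := b) (Or.inr hb.ne')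
  unfold triangleAdmittance schurAdmittance cubicForm
  refine schur_eq_div hX hq ?_ ?_
  · simp [loadedAdmittance, triangleStiffness, rowsC]
  · simp [loadedAdmittance, triangleStiffness, rowsC]
    field_simp
    ring

theorem triangleAdmittance_rowsD {c b : ℝ} (hc : 0 < c) (k₁ k₂ k₃ : ℝ) :
    triangleAdmittance rowsD c b k₁ k₂ k₃ =
      cubicForm (k₁ * k₂ + k₁ * k₃ + k₂ * k₃) (c * (k₁ + k₂)) (b * (k₂ + k₃)) (c * b)
        (k₂ + k₃) c 0 := by
  have hX : (RatFunc.X : RatFunc ℝ) ≠ 0 := RatFunc.X_ne_zero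
  have hq := quadratic_ne_zero (p := k₂ + k₃) (q := c) (r := 0) (Or.inl hc.ne')
  unfold triangleAdmittance schurAdmittance cubicForm
  refine schur_eq_div hX hq ?_ ?_
  · simp [loadedAdmittance, triangleStiffness, rowsD]
  · simp [loadedAdmittance, triangleStiffness, rowsD]
    field_simp
    ring

theorem triangleAdmittance_rowsE {c b : ℝ} (hc : 0 < c) (k₁ k₂ k₃ : ℝ) :
    triangleAdmittance rowsE c b k₁ k₂ k₃ =
      cubicForm (k₁ * k₂ + k₁ * k₃ + k₂ * k₃) (c * (k₁ + k₃)) (b * (k₁ + k₂)) (c * b)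
        (k₂ + k₃) c b := by
  have hX : (RatFunc.X : RatFunc ℝ) ≠ 0 := RatFunc.X_ne_zero
  have hq := quadratic_ne_zero (p := k₂ + k₃) (q := c) (r := b) (Or.inl hc.ne')
  unfold triangleAdmittance schurAdmittance cubicForm
  refine schur_eq_div hX hq ?_ ?_
  · simp [loadedAdmittance, triangleStiffness, rowsE]
  · simp [loadedAdmittance, triangleStiffness, rowsE]
    field_simp
    ring

theorem hasForm_cond1_iff (Y : RatFunc ℝ) : HasForm Cond1 Y ↔ RealizedByA Y := by
  have hX : (RatFunc.X : RatFunc ℝ) ≠ 0 := RatFunc.X_ne_zero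
  rw [realizedByA_iff]
  constructor
  · rintro ⟨α₀, α₁, α₂, α₃, β₁, β₂, β₃, h0, -, -, -, -, -, -, ⟨rfl, rfl, rfl, h1, h2, h3⟩, rfl⟩
    refine ⟨α₁ / β₁, α₂ / β₁, α₀ / β₁, div_pos h1 h3, div_pos h2 h3, div_nonneg h0 h3.le, ?_⟩
    have hβ : RatFunc.C β₁ ≠ (0 : RatFunc ℝ) := by simpa using h3.ne'
    simp only [map_div₀, map_zero, zero_mul, zero_add]
    field_simp
    ring
  · rintro ⟨c, b, k, hc, hb, hk, rfl⟩
    refine ⟨k, c, b, 0, 1, 0, 0, hk, hc.le, hb.le, le_rfl, zero_le_one, le_rfl, le_rfl,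
      ⟨rfl, rfl, rfl, hc, hb, one_pos⟩, ?_⟩
    simp only [map_zero, map_one]
    field_simp
    ring

/-- Spring constants of a triangle with given diagonal stiffnesses `g`, `h` and determinant `d`. -/
theorem exists_triangle_constants {g h d : ℝ} (hg : 0 ≤ g) (hh : 0 ≤ h) (h₀ : 0 ≤ g * h - d)
    (h₁ : g * h - d ≤ g ^ 2) (h₂ : g * h - d ≤ h ^ 2) :
    ∃ k₁ k₂ k₃ : ℝ, 0 ≤ k₁ ∧ 0 ≤ k₂ ∧ 0 ≤ k₃ ∧ k₁ + k₂ = g ∧ k₂ + k₃ = h ∧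
      k₁ * k₂ + k₁ * k₃ + k₂ * k₃ = d := by
  -- With `k₁ = g - k₂` and `k₃ = h - k₂`, the determinant equation becomes `k₂ ^ 2 = g * h - d`.
  refine ⟨g - √(g * h - d), √(g * h - d), h - √(g * h - d), ?_, Real.sqrt_nonneg _, ?_, by ring,
    by ring, ?_⟩
  · exact sub_nonneg.2 (Real.sqrt_le_iff.2 ⟨hg, h₁⟩)
  · exact sub_nonneg.2 (Real.sqrt_le_iff.2 ⟨hh, h₂⟩)
  · have := Real.sq_sqrt h₀
    linear_combination -this

theorem hasForm_cond2_iff (Y : RatFunc ℝ) : HasForm Cond2 Y ↔ IsTriangleAdmittance rowsB Y := by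
  constructor
  · rintro ⟨α₀, α₁, α₂, α₃, β₁, β₂, β₃, h0, h1, h2, -, hβ₁, -, -,
      ⟨rfl, hβ₂, hβ₃, e1, e2, e3, e4⟩, rfl⟩
    -- The dictionary is `c = β₂`, `b = β₃`, `h = β₁`, `d = α₀`, and `g` is the common ratio of `α₁`
    -- to `β₂` and `α₂` to `β₃`.
    obtain ⟨g, rfl⟩ : ∃ g, α₁ = β₂ * g := ⟨α₁ / β₂, by field_simp⟩
    have hα₂ : α₂ = β₃ * g := mul_right_cancel₀ hβ₂.ne' (by linear_combination -e4)
    obtain ⟨k₁, k₂, k₃, hk₁, hk₂, hk₃, rfl, rfl, rfl⟩ :=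
      exists_triangle_constants (g := g) (h := β₁) (d := α₀)
        (nonneg_of_mul_nonneg_right h1 hβ₂) hβ₁
        (nonneg_of_mul_nonneg_right (a := β₂) (by linarith) hβ₂)
        (le_of_mul_le_mul_left (a := β₂ ^ 2) (by linarith) (by positivity))
        (le_of_mul_le_mul_left (a := β₂) (by linarith) hβ₂)
    exact ⟨β₂, β₃, k₁, k₂, k₃, hβ₂, hβ₃, hk₁, hk₂, hk₃, by
      rw [triangleAdmittance_rowsB hβ₂, hα₂]; rfl⟩
  · rintro ⟨c, b, k₁, k₂, k₃, hc, hb, h₁, h₂, h₃, rfl⟩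
    refine ⟨k₁ * k₂ + k₁ * k₃ + k₂ * k₃, c * (k₁ + k₂), b * (k₁ + k₂), 0, k₂ + k₃, c, b,
      by positivity, by positivity, by positivity, le_rfl, by positivity, hc.le, hb.le,
      ⟨rfl, hc, hb, ?_, ?_, ?_, by ring⟩, triangleAdmittance_rowsB hc k₁ k₂ k₃⟩
    -- Up to powers of `c`, the three slacks are `k₂ ^ 2`, `g ^ 2 - k₂ ^ 2` and `h ^ 2 - k₂ ^ 2`.
    · have : 0 ≤ c * k₂ ^ 2 := by positivity
      linarith
    · have : 0 ≤ c ^ 2 * (k₁ ^ 2 + 2 * k₁ * k₂) := by positivity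
      linarith
    · have : 0 ≤ c * (k₃ ^ 2 + 2 * k₂ * k₃) := by positivity
      linarith

theorem hasForm_cond3_iff (Y : RatFunc ℝ) : HasForm Cond3 Y ↔ IsTriangleAdmittance rowsC Y := by
  constructor
  · rintro ⟨α₀, α₁, α₂, α₃, β₁, β₂, β₃, h0, h1, h2, -, hβ₁, -, -,
      ⟨rfl, hα₃, hβ₃, e1, e2, e3, e4⟩, rfl⟩
    obtain ⟨g, rfl⟩ : ∃ g, α₂ = β₃ * g := ⟨α₂ / β₃, by field_simp⟩
    -- The damper lies across the driving port and leaves no trace in the denominator, so `c` is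
    -- read off from `α₃ = c * b`.
    obtain ⟨c, rfl⟩ : ∃ c, α₃ = c * β₃ := ⟨α₃ / β₃, by field_simp⟩
    have hc : 0 < c := pos_of_mul_pos_left hα₃ hβ₃.le
    have hα₁ : α₁ = c * β₁ := mul_right_cancel₀ hβ₃.ne' (by linear_combination e4)
    obtain ⟨k₁, k₂, k₃, hk₁, hk₂, hk₃, rfl, rfl, rfl⟩ :=
      exists_triangle_constants (g := g) (h := β₁) (d := α₀)
        (nonneg_of_mul_nonneg_right h2 hβ₃) hβ₁
        (nonneg_of_mul_nonneg_right (a := β₃) (by linarith) hβ₃)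
        (le_of_mul_le_mul_left (a := β₃ ^ 2) (by linarith) (by positivity))
        (le_of_mul_le_mul_left (a := β₃) (by linarith) hβ₃)
    exact ⟨c, β₃, k₁, k₂, k₃, hc, hβ₃, hk₁, hk₂, hk₃, by
      rw [triangleAdmittance_rowsC hβ₃, hα₁]; rfl⟩
  · rintro ⟨c, b, k₁, k₂, k₃, hc, hb, h₁, h₂, h₃, rfl⟩
    refine ⟨k₁ * k₂ + k₁ * k₃ + k₂ * k₃, c * (k₂ + k₃), b * (k₁ + k₂), c * b, k₂ + k₃, 0, b,
      by positivity, by positivity, by positivity, by positivity, by positivity, le_rfl, hb.le,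
      ⟨rfl, by positivity, hb, ?_, ?_, ?_, by ring⟩, triangleAdmittance_rowsC hb k₁ k₂ k₃⟩
    · have : 0 ≤ b * k₂ ^ 2 := by positivity
      linarith
    · have : 0 ≤ b ^ 2 * (k₁ ^ 2 + 2 * k₁ * k₂) := by positivity
      linarith
    · have : 0 ≤ b * (k₃ ^ 2 + 2 * k₂ * k₃) := by positivity
      linarith

theorem hasForm_cond4_iff (Y : RatFunc ℝ) : HasForm Cond4 Y ↔ IsTriangleAdmittance rowsD Y := by
  constructor
  · rintro ⟨α₀, α₁, α₂, α₃, β₁, β₂, β₃, h0, h1, h2, -, hβ₁, -, -,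
      ⟨rfl, hα₃, hβ₂, e1, e2, e3, e4⟩, rfl⟩
    obtain ⟨g, rfl⟩ : ∃ g, α₁ = β₂ * g := ⟨α₁ / β₂, by field_simp⟩
    obtain ⟨b, rfl⟩ : ∃ b, α₃ = β₂ * b := ⟨α₃ / β₂, by field_simp⟩
    have hb : 0 < b := pos_of_mul_pos_right hα₃ hβ₂.le
    have hα₂ : α₂ = b * β₁ := mul_right_cancel₀ hβ₂.ne' (by linear_combination -e4)
    obtain ⟨k₁, k₂, k₃, hk₁, hk₂, hk₃, rfl, rfl, rfl⟩ :=
      exists_triangle_constants (g := g) (h := β₁) (d := α₀)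
        (nonneg_of_mul_nonneg_right h1 hβ₂) hβ₁
        (nonneg_of_mul_nonneg_right (a := β₂) (by linarith) hβ₂)
        (le_of_mul_le_mul_left (a := β₂ ^ 2) (by linarith) (by positivity))
        (le_of_mul_le_mul_left (a := β₂) (by linarith) hβ₂)
    exact ⟨β₂, b, k₁, k₂, k₃, hβ₂, hb, hk₁, hk₂, hk₃, by
      rw [triangleAdmittance_rowsD hβ₂, hα₂]; rfl⟩
  · rintro ⟨c, b, k₁, k₂, k₃, hc, hb, h₁, h₂, h₃, rfl⟩
    refine ⟨k₁ * k₂ + k₁ * k₃ + k₂ * k₃, c * (k₁ + k₂), b * (k₂ + k₃), c * b, k₂ + k₃, c, 0,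
      by positivity, by positivity, by positivity, by positivity, by positivity, hc.le, le_rfl,
      ⟨rfl, by positivity, hc, ?_, ?_, ?_, by ring⟩, triangleAdmittance_rowsD hc k₁ k₂ k₃⟩
    · have : 0 ≤ c * k₂ ^ 2 := by positivity
      linarith
    · have : 0 ≤ c ^ 2 * (k₁ ^ 2 + 2 * k₁ * k₂) := by positivity
      linarith
    · have : 0 ≤ c * (k₃ ^ 2 + 2 * k₂ * k₃) := by positivity
      linarith

theorem hasForm_cond5_iff (Y : RatFunc ℝ) : HasForm Cond5 Y ↔ IsTriangleAdmittance rowsE Y := by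
  constructor
  · rintro ⟨α₀, α₁, α₂, α₃, β₁, c, b, -, -, -, -, -, -, -,
      ⟨hα₃, hc, hb, e1, e2, e3, rfl, e5⟩, rfl⟩
    obtain ⟨p, rfl⟩ : ∃ p, α₁ = c * p := ⟨α₁ / c, by field_simp⟩
    obtain ⟨q, rfl⟩ : ∃ q, α₂ = b * q := ⟨α₂ / b, by field_simp⟩
    have hpos : 0 < c * b := mul_pos hc hb
    have i1 : 0 ≤ p + q - β₁ := nonneg_of_mul_nonneg_right (a := c * b) (by linarith) hpos
    have i2 : 0 ≤ q + β₁ - p := nonneg_of_mul_nonneg_right (a := c * b) (by linarith) hpos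
    have i3 : 0 ≤ p + β₁ - q := nonneg_of_mul_nonneg_right (a := c * b) (by linarith) hpos
    have i5 : p ^ 2 + q ^ 2 + β₁ ^ 2 + 4 * α₀ = 2 * (p * q + q * β₁ + β₁ * p) :=
      mul_left_cancel₀ (pow_pos hpos 2).ne' (by linear_combination e5)
    -- Solution of `k₁ + k₃ = p`, `k₁ + k₂ = q`, `k₂ + k₃ = β₁`.
    refine ⟨c, b, (p + q - β₁) / 2, (q + β₁ - p) / 2, (p + β₁ - q) / 2, hc, hb, by positivity,
      by positivity, by positivity, ?_⟩
    rw [triangleAdmittance_rowsE hc]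
    change cubicForm _ _ _ _ _ _ _ = _
    congr 1
    · linear_combination i5 / 4
    all_goals ring
  · rintro ⟨c, b, k₁, k₂, k₃, hc, hb, h₁, h₂, h₃, rfl⟩
    refine ⟨k₁ * k₂ + k₁ * k₃ + k₂ * k₃, c * (k₁ + k₃), b * (k₁ + k₂), c * b, k₂ + k₃, c, b,
      by positivity, by positivity, by positivity, by positivity, by positivity, hc.le, hb.le,
      ⟨by positivity, hc, hb, ?_, ?_, ?_, rfl, by ring⟩, triangleAdmittance_rowsE hc k₁ k₂ k₃⟩
    · have : 0 ≤ c * b * k₁ := by positivity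
      linarith
    · have : 0 ≤ c * b * k₂ := by positivity
      linarith
    · have : 0 ≤ c * b * k₃ := by positivity
      linarith

/-! ### The networks (a) to (e) have no well-defined admittance. -/

/-- An admittance would allow every velocity vector, so one vector violating the loop law of the
ports refutes it. -/
theorem not_hasWellDefinedAdmittance_of_dependent {V S : Type} [DecidableEq V] [Fintype S]
    {N : SpringNetwork V (Fin 3) S} (x : Fin 3 → RatFunc ℝ)
    (h : ∀ u : V → RatFunc ℝ, (∀ p, x p = u (N.port p).1 - u (N.port p).2) → False) :
    ¬ N.HasWellDefinedAdmittance := by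
  rintro ⟨A, hA⟩
  obtain ⟨u, hu, -⟩ := (hA x _).2 rfl
  exact h u hu

theorem card_pos_constants_le (k : Fin 3 → ℝ) [Fintype {j : Fin 3 // 0 < k j}] :
    Fintype.card {j : Fin 3 // 0 < k j} ≤ 3 := by
  simpa using Fintype.card_subtype_le fun j : Fin 3 => 0 < k j

theorem RealizedByA.realizableWithoutAdmittance {Y : RatFunc ℝ} (h : RealizedByA Y) :
    RealizableWithoutAdmittance Y := by
  obtain ⟨c, b, k, hc, hb, -, hY⟩ := h
  refine ⟨_, _, inferInstance, inferInstance, inferInstance, networkA k, c, b, ?_, hc, hb,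
    not_hasWellDefinedAdmittance_of_dependent ![1, 0, 0] fun u hu => ?_, hY⟩
  · have := Fintype.card_subtype_le fun j : Fin 1 => 0 < ![k] j
    rw [Fintype.card_fin] at this
    linarith
  · have h0 := hu 0
    have h1 := hu 1
    simp [networkA, ofConstants] at h0 h1
    rw [← h1] at h0
    exact one_ne_zero h0

theorem realizableWithoutAdmittance_of_realizedBy
    {N : ∀ k₁ k₂ k₃ : ℝ, SpringNetwork (Fin 3) (Fin 3) {j : Fin 3 // 0 < ![k₁, k₂, k₃] j}}
    (hN : ∀ k₁ k₂ k₃, ¬ (N k₁ k₂ k₃).HasWellDefinedAdmittance) {Y : RatFunc ℝ}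
    (h : RealizedBy N Y) : RealizableWithoutAdmittance Y := by
  obtain ⟨c, b, k₁, k₂, k₃, hc, hb, -, -, -, hY⟩ := h
  exact ⟨_, _, inferInstance, inferInstance, inferInstance, N k₁ k₂ k₃, c, b,
    card_pos_constants_le _, hc, hb, hN _ _ _, hY⟩

theorem not_hasWellDefinedAdmittance_networkB (k₁ k₂ k₃ : ℝ) :
    ¬ (networkB k₁ k₂ k₃).HasWellDefinedAdmittance :=
  not_hasWellDefinedAdmittance_of_dependent ![0, 1, 0] fun u hu => by
    have h1 := hu 1
    have h2 := hu 2
    simp [networkB, triangleNetwork, ofConstants] at h1 h2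
    rw [← h2] at h1
    exact one_ne_zero h1

theorem not_hasWellDefinedAdmittance_networkC (k₁ k₂ k₃ : ℝ) :
    ¬ (networkC k₁ k₂ k₃).HasWellDefinedAdmittance :=
  not_hasWellDefinedAdmittance_of_dependent ![1, 0, 0] fun u hu => by
    have h1 := hu 0
    have h2 := hu 1
    simp [networkC, triangleNetwork, ofConstants] at h1 h2
    rw [← h2] at h1
    exact one_ne_zero h1

theorem not_hasWellDefinedAdmittance_networkD (k₁ k₂ k₃ : ℝ) :
    ¬ (networkD k₁ k₂ k₃).HasWellDefinedAdmittance :=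
  not_hasWellDefinedAdmittance_of_dependent ![1, 0, 0] fun u hu => by
    have h1 := hu 0
    have h2 := hu 2
    simp [networkD, triangleNetwork, ofConstants] at h1 h2
    rw [← h2] at h1
    exact one_ne_zero h1

theorem not_hasWellDefinedAdmittance_networkE (k₁ k₂ k₃ : ℝ) :
    ¬ (networkE k₁ k₂ k₃).HasWellDefinedAdmittance :=
  not_hasWellDefinedAdmittance_of_dependent ![1, 0, 0] fun u hu => by
    have h0 := hu 0
    have h1 := hu 1
    have h2 := hu 2
    simp [networkE, triangleNetwork, ofConstants] at h0 h1 h2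
    exact one_ne_zero (α := RatFunc ℝ) (by linear_combination h0 - h1 - h2)

end SpringNetwork

theorem hasForm_or {C C' : ℝ → ℝ → ℝ → ℝ → ℝ → ℝ → ℝ → Prop} {Y : RatFunc ℝ} :
    HasForm (fun α₀ α₁ α₂ α₃ β₁ β₂ β₃ => C α₀ α₁ α₂ α₃ β₁ β₂ β₃ ∨ C' α₀ α₁ α₂ α₃ β₁ β₂ β₃) Y ↔
      HasForm C Y ∨ HasForm C' Y := by
  simp only [HasForm, or_and_right, and_or_left, exists_or]

open SpringNetwork

theorem theorem6 (Y : RatFunc ℝ) :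
    (RealizableWithoutAdmittance Y ↔
      HasForm (fun α₀ α₁ α₂ α₃ β₁ β₂ β₃ =>
        Cond1 α₀ α₁ α₂ α₃ β₁ β₂ β₃ ∨ Cond2 α₀ α₁ α₂ α₃ β₁ β₂ β₃ ∨
        Cond3 α₀ α₁ α₂ α₃ β₁ β₂ β₃ ∨ Cond4 α₀ α₁ α₂ α₃ β₁ β₂ β₃ ∨
        Cond5 α₀ α₁ α₂ α₃ β₁ β₂ β₃) Y) ∧
    (HasForm Cond1 Y ↔ RealizedByA Y) ∧
    (HasForm Cond2 Y ↔ RealizedBy networkB Y) ∧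
    (HasForm Cond3 Y ↔ RealizedBy networkC Y) ∧
    (HasForm Cond4 Y ↔ RealizedBy networkD Y) ∧
    (HasForm Cond5 Y ↔ RealizedBy networkE Y) := by
  have hB := realizedBy_iff rfl (by simp [rowsB]) networkB_hasReduction Y
  have hC := realizedBy_iff rfl (by simp [rowsC]) networkC_hasReduction Y
  have hD := realizedBy_iff rfl (by simp [rowsD]) networkD_hasReduction Y
  have hE := realizedBy_iff rfl (by simp [rowsE]) networkE_hasReduction Y
  refine ⟨?_, hasForm_cond1_iff Y, (hasForm_cond2_iff Y).trans hB.symm,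
    (hasForm_cond3_iff Y).trans hC.symm, (hasForm_cond4_iff Y).trans hD.symm,
    (hasForm_cond5_iff Y).trans hE.symm⟩
  -- Each alternative has its own coefficients, so the disjunction of conditions splits into five
  -- separate realizability statements.
  rw [hasForm_or, hasForm_or, hasForm_or, hasForm_or, hasForm_cond1_iff, hasForm_cond2_iff,
    hasForm_cond3_iff, hasForm_cond4_iff, hasForm_cond5_iff]
  constructor
  · rintro ⟨V, S, _, _, _, N, c, b, -, hc, hb, hN, hY⟩
    rcases N.reduces_of_not_hasWellDefinedAdmittance hN with h | h | h | h | h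
    · exact Or.inl (h.realizedByA hc hb hY)
    · exact Or.inr (Or.inl (h.isTriangleAdmittance rfl (by simp [rowsB]) hc hb hY))
    · exact Or.inr (Or.inr (Or.inl (h.isTriangleAdmittance rfl (by simp [rowsC]) hc hb hY)))
    · exact Or.inr (Or.inr (Or.inr (Or.inl
        (h.isTriangleAdmittance rfl (by simp [rowsD]) hc hb hY))))
    · exact Or.inr (Or.inr (Or.inr (Or.inr
        (h.isTriangleAdmittance rfl (by simp [rowsE]) hc hb hY))))
  · rw [← hB, ← hC, ← hD, ← hE]
    rintro (h | h | h | h | h)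
    · exact RealizedByA.realizableWithoutAdmittance h
    · exact realizableWithoutAdmittance_of_realizedBy not_hasWellDefinedAdmittance_networkB h
    · exact realizableWithoutAdmittance_of_realizedBy not_hasWellDefinedAdmittance_networkC h
    · exact realizableWithoutAdmittance_of_realizedBy not_hasWellDefinedAdmittance_networkD h
    · exact realizableWithoutAdmittance_of_realizedBy not_hasWellDefinedAdmittance_networkE h
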